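/- In the metric allocation problem (MAP) on a finite metric space $M$ with $n\ge 1$ points, an algorithm maintains an allocation in the simplex $\Delta=\{x\in\mathbb{R}_{\ge 0}^M : \sum_{i\in M}x_i=1\}$, starting from a given $x(0)\in\Delta$. At each time step $t=1,2,\dots$ a convex non-increasing cost function $c_{t,i}\colon[0,1]\to\mathbb{R}_{\ge 0}$ is revealed for every $i\in M$. An online algorithm then chooses $x(t)\in\Delta$, depending only on $x(0)$ and the cost functions revealed in steps $1,\dots,t$; it pays the service cost $\sum_{i\in M} c_{t,i}(x_i(t))$ and the movement cost $\|x(t)-x(t-1)\|$, where $\|z\|$ is the minimum of $\sum_{i,j\in M}f(i,j)\,d(i,j)$ over all $f\colon M\times M\to\mathbb{R}_{\ge 0}$ with $z_i=\sum_{j\in M}(f(j,i)-f(i,j))$ for all $i$. The algorithm has $\alpha$-competitive service cost (respectively $\beta$-competitive movement cost) if there is a constant $K$, independent of $x(0)$, of the cost functions and of the number of steps, such that for every sequence of cost functions, every number of steps $T$ and every offline sequence $y(0),\dots,y(T)\in\Delta$, its total service cost over steps $1,\dots,T$ is at most $\alpha$ times (respectively its total movement cost is at most $\beta$ times) the total movement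 plus service cost of $y$, plus $K$. The space $M$ is a weighted star if there are weights $w_i>0$ such that $d(i,j)=w_i+w_j$ for all $i\neq j$. Theorem. There is an absolute constant $C>0$ such that for every weighted star $M$ with $n\ge1$ points and every $\epsilon>0$ there is a single deterministic online algorithm for MAP on $M$ that has $(1+\epsilon)$-competitive service cost and $C\left(\frac1\epsilon+\log n\right)$-competitive movement cost. -/

import Mathlib

/-- A weighted star: there are weights `w i > 0` such that the distance between two distinct
points `i` and `j` is `w i + w j`. -/
def IsWeightedStar (M : Type*) [MetricSpace M] : Prop :=
  ∃ w : M → ℝ, (∀ i, 0 < w i) ∧ ∀ i j, i ≠ j → dist i j = w i + w j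

/-- An allocation of the resource: a point of the simplex
`{x : M → ℝ | (∀ i, 0 ≤ x i) ∧ ∑ i, x i = 1}`. -/
abbrev Allocation (M : Type*) [Fintype M] : Type _ := stdSimplex ℝ M

/-- A convex non-increasing cost function `[0, 1] → ℝ₊`. `Set.IccExtend` agrees with `toFun`
on `[0, 1]`, so the last field is convexity of the function on `[0, 1]`. -/
structure CostFunction where
  toFun : Set.Icc (0 : ℝ) 1 → ℝ
  nonneg : ∀ u, 0 ≤ toFun u
  antitone : Antitone toFun
  convex : ConvexOn ℝ (Set.Icc (0 : ℝ) 1) (Set.IccExtend zero_le_one toFun)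

/-- The tasks arriving in one time step: one cost function at each point. -/
abbrev TaskVector (M : Type*) : Type _ := M → CostFunction

/-- Service cost `∑ i, c i (x i)` of one time step. -/
noncomputable def stepServiceCost {M : Type*} [Fintype M] (c : TaskVector M) (x : Allocation M) : ℝ :=
  ∑ i, (c i).toFun ⟨x.1 i, mem_Icc_of_mem_stdSimplex x.2 i⟩

/-- The norm induced by the metric on vectors with zero sum: the least cost
`∑ i j, f i j * d(i, j)` of a flow `f ≥ 0` that has net inflow `z i` at every point `i`. -/
noncomputable def transportNorm {M : Type*} [Fintype M] [MetricSpace M] (z : M → ℝ) : ℝ :=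
  sInf {κ : ℝ | ∃ f : M → M → ℝ, (∀ i j, 0 ≤ f i j) ∧ (∀ i, z i = ∑ j, (f j i - f i j)) ∧
    κ = ∑ i, ∑ j, f i j * dist i j}

/-- Cost of moving from the allocation `x` to the allocation `y`. -/
noncomputable def stepMovementCost {M : Type*} [Fintype M] [MetricSpace M]
    (x y : Allocation M) : ℝ :=
  transportNorm fun i => y.1 i - x.1 i

/-- Total service cost of the trajectory `x 0, x 1, …, x T`. The tasks revealed in time step
`t + 1` are `c t`, and they are paid at the new allocation `x (t + 1)`. -/
noncomputable def serviceCost {M : Type*} [Fintype M]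
    (c : ℕ → TaskVector M) (x : ℕ → Allocation M) (T : ℕ) : ℝ :=
  ∑ t ∈ Finset.range T, stepServiceCost (c t) (x (t + 1))

/-- Total movement cost of the trajectory `x 0, x 1, …, x T`. -/
noncomputable def movementCost {M : Type*} [Fintype M] [MetricSpace M]
    (x : ℕ → Allocation M) (T : ℕ) : ℝ :=
  ∑ t ∈ Finset.range T, stepMovementCost (x t) (x (t + 1))

/-- A deterministic online algorithm: given the initial allocation and the list of all tasks
revealed so far (the current ones last), it chooses the new allocation. -/
structure OnlineAlgorithm (M : Type*) [Fintype M] where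
  next : Allocation M → List (TaskVector M) → Allocation M

/-- The trajectory of the algorithm that starts at `x₀` and receives the tasks `c 0, c 1, …`. -/
def OnlineAlgorithm.run {M : Type*} [Fintype M] (A : OnlineAlgorithm M) (x₀ : Allocation M)
    (c : ℕ → TaskVector M) : ℕ → Allocation M
  | 0 => x₀
  | t + 1 => A.next x₀ ((List.range (t + 1)).map c)

/-- The service cost of `A` is at most `α` times the total (movement plus service) cost of every
offline trajectory `y`, up to an additive constant that depends only on the algorithm. -/
def HasCompetitiveServiceCost {M : Type*} [Fintype M] [MetricSpace M]
    (A : OnlineAlgorithm M) (α : ℝ) : Prop :=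
  ∃ K : ℝ, ∀ (x₀ : Allocation M) (c : ℕ → TaskVector M) (T : ℕ) (y : ℕ → Allocation M),
    serviceCost c (A.run x₀ c) T ≤ α * (movementCost y T + serviceCost c y T) + K

/-- The movement cost of `A` is at most `β` times the total (movement plus service) cost of every
offline trajectory `y`, up to an additive constant that depends only on the algorithm. -/
def HasCompetitiveMovementCost {M : Type*} [Fintype M] [MetricSpace M]
    (A : OnlineAlgorithm M) (β : ℝ) : Prop :=
  ∃ K : ℝ, ∀ (x₀ : Allocation M) (c : ℕ → TaskVector M) (T : ℕ) (y : ℕ → Allocation M),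
    movementCost (A.run x₀ c) T ≤ β * (movementCost y T + serviceCost c y T) + K

/-!
The resource `[0, 1]` of every point `i` is cut into infinitesimal slots, and the algorithm keeps a
fractional state: the function `u i`, whose value at `z` is the missing fraction of slot `z`. It
stands for the allocation `x i = 1 - ∫ u i`. An offline allocation `y` has the missing profile that
is `0` below `y i` and `1` above it. The algorithm is online mirror descent on the slots, with the
entropic regularizer `∑ i, ω i * ∫ (u i + δ) * log (u i + δ)`, where `δ = 1 / n` and
`ω i = w i / log n`.

A cost function acts through a supporting hinge `x ↦ s * max 0 (b - x)`. The answer (`lower`)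
multiplies `u i + δ` by `exp (-r)` on the slots up to `b`. The Bregman divergence `servicePot` from
the state to the offline profiles then grows by at most the offline minus the online service cost
(`IsProfile.energy_sub_logTail_lower`). Now too much resource is used, and some has to be evicted.
Eviction (`raise`) multiplies `u i + δ` by `exp r` only on the top part of length `τ` of each
profile, the interval from `height - τ` to `height`, where the heights add up to `1 + τ`. The key
inequality (`le_sum_max_min`) is that for every allocation `y` these intervals have total length at
least `τ` above `y`, that is, in slots that are empty offline. It has two consequences
(`raise_all`):

* eviction does not increase `servicePot`, so the service cost is even `1`-competitive;
* with `r = t / ω i` at point `i`, eviction costs at most `2 * t * τ` of movement, and it increases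
  `tailPot`, the weighted sum of the integrals of `log (u i + δ)` above `y i`, by at least `t * τ`,
  up to losses from saturated slots, which telescope.
  A request decreases `tailPot` by at most the offline service cost, and an offline movement changes
  it by at most its cost. As `tailPot` is bounded, the movement cost, measured with `ω`, is
  `4`-competitive, and measured with `w = ω * log n` it is `4 * log n`-competitive.

Both steps are infinitesimal in the ideal algorithm. Here a time step is split into many short
rounds of answering and evicting (`exists_round`), and the allocation that is played is the
cheapest one visited on the way (`exists_rounds`); its cost is at most the average over the rounds.
Mixing in a little of the uniform allocation keeps the slopes of the cost functions bounded
(`exists_step`). The errors of the time steps are summable and go into the additive constant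
(`exists_algorithm`). On a star the transport norm is the weighted `ℓ¹` norm (`transportNorm_eq`).
A space with one point has only one allocation.
-/

open MeasureTheory

/-! ### Profiles -/

/-- The missing profile of a single point of the space: `u z` is the fraction of the resource slot
`z ∈ [0, 1]` of that point that is not filled. Monotonicity says that lower slots are filled
first. Only the values on `[0, 1]` matter; asking for the conditions on all of `ℝ` makes them
handier. -/
structure IsProfile (u : ℝ → ℝ) : Prop where
  mono : Monotone u
  nonneg : ∀ z, 0 ≤ u z
  le_one : ∀ z, u z ≤ 1

/-- The total missing amount of a profile, so that `1 - mass u` is the amount of resource. -/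
noncomputable def mass (u : ℝ → ℝ) : ℝ := ∫ z in (0 : ℝ)..1, u z

/-- The height of a profile: slots below it are partly filled, slots above it are empty. -/
noncomputable def height (u : ℝ → ℝ) : ℝ := ∫ z in (0 : ℝ)..1, if u z < 1 then 1 else 0

/-- The Bregman divergence of `x ↦ (x + δ) * log (x + δ)` from `u z` to `a` is, up to terms that do
not depend on `u`, equal to `u z - δ * log (u z + δ) - a * log (u z + δ)`. This is the integral
over the slots of the part that does not involve the target `a`. -/
noncomputable def energy (δ : ℝ) (u : ℝ → ℝ) : ℝ :=
  ∫ z in (0 : ℝ)..1, (u z - δ * Real.log (u z + δ))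

/-- The remaining part `a * log (u z + δ)` of the Bregman divergence, integrated over the slots.
The target is `a = 1` on the slots above the offline allocation `y`, which are empty offline, and
`a = 0` on the slots below it, which are full offline. -/
noncomputable def logTail (δ y : ℝ) (u : ℝ → ℝ) : ℝ := ∫ z in y..1, Real.log (u z + δ)

theorem Measurable.intervalIntegrable_of_abs_le {f : ℝ → ℝ} (hf : Measurable f) (C : ℝ)
    (h : ∀ z, |f z| ≤ C) (a b : ℝ) : IntervalIntegrable f volume a b := by
  have key : ∀ a b : ℝ, IntegrableOn f (Set.Ioc a b) volume := fun a b =>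
    Measure.integrableOn_of_bounded (M := C) (by simp) hf.aestronglyMeasurable
      (Filter.Eventually.of_forall h)
  exact ⟨key a b, key b a⟩

theorem integral_ite_Ioc (p q : ℝ) :
    ∫ z in (0 : ℝ)..1, (if p < z ∧ z ≤ q then (1 : ℝ) else 0) =
      max 0 (min q 1 - max p 0) := by
  have h1 : (fun z : ℝ => if p < z ∧ z ≤ q then (1 : ℝ) else 0) =
      (Set.Ioc p q).indicator 1 := by
    funext z
    simp [Set.indicator, Set.mem_Ioc]
  rw [h1, intervalIntegral.integral_of_le zero_le_one, integral_indicator_one measurableSet_Ioc,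
    measureReal_restrict_apply measurableSet_Ioc, Set.Ioc_inter_Ioc, Real.volume_real_Ioc, max_comm]

theorem integral_ite_lt (p : ℝ) (hp0 : 0 ≤ p) (hp1 : p ≤ 1) :
    ∫ z in (0 : ℝ)..1, (if p < z then (1 : ℝ) else 0) = 1 - p := by
  have h : ∫ z in (0 : ℝ)..1, (if p < z then (1 : ℝ) else 0) =
      ∫ z in (0 : ℝ)..1, (if p < z ∧ z ≤ 1 then (1 : ℝ) else 0) := by
    refine intervalIntegral.integral_congr fun z hz => ?_
    rw [Set.uIcc_of_le zero_le_one] at hz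
    simp [hz.2]
  rw [h, integral_ite_Ioc, min_self, max_eq_left hp0, max_eq_right (by linarith)]

theorem measurable_ite_lt (p : ℝ) {f : ℝ → ℝ} (hf : Measurable f) :
    Measurable fun z => if p < z then f z else 0 :=
  Measurable.ite measurableSet_Ioi hf measurable_const

theorem measurable_ite_Ioc (p q : ℝ) :
    Measurable fun z : ℝ => if p < z ∧ z ≤ q then (1 : ℝ) else 0 :=
  Measurable.ite measurableSet_Ioc measurable_const measurable_const

theorem integral_ite_Ioo (p q : ℝ) :
    ∫ z in (0 : ℝ)..1, (if p < z ∧ z < q then (1 : ℝ) else 0) =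
      max 0 (min q 1 - max p 0) := by
  rw [← integral_ite_Ioc]
  refine intervalIntegral.integral_congr_ae ?_
  filter_upwards [Measure.ae_ne volume q] with z hz _
  simp [le_iff_lt_or_eq, hz]

theorem measurable_ite_Ioo (p q : ℝ) :
    Measurable fun z : ℝ => if p < z ∧ z < q then (1 : ℝ) else 0 :=
  Measurable.ite measurableSet_Ioo measurable_const measurable_const

namespace IsProfile

variable {u v : ℝ → ℝ} {δ : ℝ}

theorem measurable (hu : IsProfile u) : Measurable u := hu.mono.measurable

theorem intervalIntegrable (hu : IsProfile u) (a b : ℝ) : IntervalIntegrable u volume a b :=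
  hu.mono.intervalIntegrable

theorem measurable_lt_one (hu : IsProfile u) :
    Measurable fun z => if u z < 1 then (1 : ℝ) else 0 :=
  Measurable.ite (measurableSet_lt hu.measurable measurable_const) measurable_const
    measurable_const

theorem intervalIntegrable_lt_one (hu : IsProfile u) (a b : ℝ) :
    IntervalIntegrable (fun z => if u z < 1 then (1 : ℝ) else 0) volume a b :=
  hu.measurable_lt_one.intervalIntegrable_of_abs_le 1
    (fun z => by split_ifs <;> simp) a b

theorem log_mem (hu : IsProfile u) (hδ : 0 < δ) (z : ℝ) :
    Real.log δ ≤ Real.log (u z + δ) ∧ Real.log (u z + δ) ≤ Real.log (1 + δ) :=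
  ⟨Real.log_le_log hδ (by linarith [hu.nonneg z]),
    Real.log_le_log (by linarith [hu.nonneg z]) (by linarith [hu.le_one z])⟩

theorem monotone_log (hu : IsProfile u) (hδ : 0 < δ) : Monotone fun z => Real.log (u z + δ) :=
  fun x y h => Real.log_le_log (by linarith [hu.nonneg x]) (by linarith [hu.mono h])

theorem intervalIntegrable_log (hu : IsProfile u) (hδ : 0 < δ) (a b : ℝ) :
    IntervalIntegrable (fun z => Real.log (u z + δ)) volume a b :=
  (hu.monotone_log hδ).intervalIntegrable

theorem intervalIntegrable_log_tail (hu : IsProfile u) (hδ : 0 < δ) (y a b : ℝ) :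
    IntervalIntegrable (fun z => if y < z then Real.log (u z + δ) else 0) volume a b := by
  refine (measurable_ite_lt y (hu.monotone_log hδ).measurable).intervalIntegrable_of_abs_le
    (|Real.log δ| + |Real.log (1 + δ)|) (fun z => ?_) a b
  have h := hu.log_mem hδ z
  split_ifs
  · rw [abs_le]
    constructor
    · linarith [neg_abs_le (Real.log δ), abs_nonneg (Real.log (1 + δ))]
    · linarith [le_abs_self (Real.log (1 + δ)), abs_nonneg (Real.log δ)]
  · rw [abs_zero]
    positivity

theorem logTail_eq (hu : IsProfile u) (hδ : 0 < δ) {y : ℝ} (hy0 : 0 ≤ y) (hy1 : y ≤ 1) :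
    logTail δ y u = ∫ z in (0 : ℝ)..1, if y < z then Real.log (u z + δ) else 0 := by
  rw [← intervalIntegral.integral_add_adjacent_intervals (b := y)
    (hu.intervalIntegrable_log_tail hδ y 0 y) (hu.intervalIntegrable_log_tail hδ y y 1)]
  have h1 : ∫ z in (0 : ℝ)..y, (if y < z then Real.log (u z + δ) else 0) = 0 := by
    rw [intervalIntegral.integral_congr (g := fun _ => (0 : ℝ))]
    · simp
    · intro z hz
      rw [Set.uIcc_of_le hy0] at hz
      simp [not_lt.2 hz.2]
  have h2 : ∫ z in y..1, (if y < z then Real.log (u z + δ) else 0) = logTail δ y u := by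
    rw [logTail, intervalIntegral.integral_of_le hy1, intervalIntegral.integral_of_le hy1]
    refine setIntegral_congr_fun measurableSet_Ioc fun z hz => ?_
    simp [hz.1]
  rw [h1, h2, zero_add]

theorem mass_nonneg (hu : IsProfile u) : 0 ≤ mass u :=
  intervalIntegral.integral_nonneg zero_le_one fun z _ => hu.nonneg z

theorem mass_le_one (hu : IsProfile u) : mass u ≤ 1 := by
  have := intervalIntegral.integral_mono_on zero_le_one (hu.intervalIntegrable 0 1)
    (intervalIntegrable_const (c := (1 : ℝ))) fun z _ => hu.le_one z
  simpa [mass] using this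

theorem height_nonneg (u : ℝ → ℝ) : 0 ≤ height u :=
  intervalIntegral.integral_nonneg zero_le_one fun z _ => by split_ifs <;> simp

theorem height_le_one (hu : IsProfile u) : height u ≤ 1 := by
  have := intervalIntegral.integral_mono_on zero_le_one (hu.intervalIntegrable_lt_one 0 1)
    (intervalIntegrable_const (c := (1 : ℝ))) fun z _ => by split_ifs <;> simp
  simpa [height] using this

theorem eq_one_of_height_lt (hu : IsProfile u) {z : ℝ} (hz0 : 0 ≤ z) (hz1 : z ≤ 1)
    (h : height u < z) : u z = 1 := by
  by_contra hne
  have hlt : u z < 1 := lt_of_le_of_ne (hu.le_one z) hne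
  have h1 := intervalIntegral.integral_mono_on zero_le_one
    ((measurable_ite_Ioc 0 z).intervalIntegrable_of_abs_le 1
      (fun z => by split_ifs <;> simp) 0 1) (hu.intervalIntegrable_lt_one 0 1)
    (fun x _ => by
      by_cases hx : x ≤ z
      · have : u x < 1 := (hu.mono hx).trans_lt hlt
        simp only [this, if_true]
        split_ifs <;> simp
      · simp only [hx, and_false, if_false]
        split_ifs <;> simp)
  rw [integral_ite_Ioc, min_eq_left hz1, max_self, sub_zero, max_eq_right hz0] at h1
  exact absurd h (not_lt.2 h1)

theorem lt_one_of_lt_height (hu : IsProfile u) {z : ℝ} (hz0 : 0 ≤ z)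
    (h : z < height u) : u z < 1 := by
  by_contra hge
  have hge : 1 ≤ u z := not_lt.1 hge
  have hz1 : z ≤ 1 := h.le.trans hu.height_le_one
  have h1 := intervalIntegral.integral_mono_on zero_le_one (hu.intervalIntegrable_lt_one 0 1)
    ((measurable_ite_Ioc (-1) z).intervalIntegrable_of_abs_le 1
      (fun z => by split_ifs <;> simp) 0 1)
    (fun x hx => by
      by_cases hxz : x ≤ z
      · have : -1 < x := by linarith [hx.1]
        simp only [this, hxz, and_self, if_true]
        split_ifs <;> simp
      · have : ¬ u x < 1 := not_lt.2 (hge.trans (hu.mono (not_le.1 hxz).le))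
        simp [this, hxz])
  rw [integral_ite_Ioc, min_eq_left hz1, max_eq_right (by norm_num : (-1 : ℝ) ≤ 0), sub_zero,
    max_eq_right hz0] at h1
  exact absurd h (not_lt.2 h1)

/-- A profile misses everything above its height. -/
theorem one_sub_height_le_mass (hu : IsProfile u) : 1 - height u ≤ mass u := by
  have h := intervalIntegral.integral_mono_on zero_le_one
    ((intervalIntegrable_const (c := (1 : ℝ))).sub (hu.intervalIntegrable_lt_one 0 1))
    (hu.intervalIntegrable 0 1) fun z _ => by
      by_cases hz : u z < 1
      · simpa [hz] using hu.nonneg z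
      · simpa [hz] using not_lt.1 hz
  rw [intervalIntegral.integral_sub (intervalIntegrable_const (c := (1 : ℝ)))
    (hu.intervalIntegrable_lt_one 0 1)] at h
  simpa [mass, height] using h

theorem mass_mono (hu : IsProfile u) (hv : IsProfile v) (h : ∀ z, u z ≤ v z) :
    mass u ≤ mass v :=
  intervalIntegral.integral_mono_on zero_le_one (hu.intervalIntegrable 0 1)
    (hv.intervalIntegrable 0 1) fun z _ => h z

theorem logTail_mono (hu : IsProfile u) (hv : IsProfile v) (hδ : 0 < δ) {y : ℝ} (hy1 : y ≤ 1)
    (h : ∀ z, u z ≤ v z) : logTail δ y u ≤ logTail δ y v :=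
  intervalIntegral.integral_mono_on hy1 (hu.intervalIntegrable_log hδ y 1)
    (hv.intervalIntegrable_log hδ y 1) fun z _ =>
      Real.log_le_log (by linarith [hu.nonneg z]) (by linarith [h z])

/-- The logarithms are bounded by `Λ`, so that an offline movement costs `Λ` per unit. -/
theorem abs_logTail_sub_le (hu : IsProfile u) (hδ : 0 < δ) {Λ : ℝ} (h1 : -Λ ≤ Real.log δ)
    (h2 : Real.log (1 + δ) ≤ Λ) (y y' : ℝ) :
    |logTail δ y' u - logTail δ y u| ≤ Λ * |y' - y| := by
  have h : logTail δ y' u - logTail δ y u = ∫ z in y'..y, Real.log (u z + δ) := by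
    rw [logTail, logTail, ← intervalIntegral.integral_add_adjacent_intervals (b := y)
      (hu.intervalIntegrable_log hδ y' y) (hu.intervalIntegrable_log hδ y 1)]
    ring
  rw [h, abs_sub_comm y' y]
  exact intervalIntegral.norm_integral_le_of_norm_le_const (f := fun z => Real.log (u z + δ))
    fun z _ => abs_le.2 ⟨h1.trans (hu.log_mem hδ z).1, (hu.log_mem hδ z).2.trans h2⟩

theorem abs_logTail_le (hu : IsProfile u) (hδ : 0 < δ) {Λ : ℝ} (h1 : -Λ ≤ Real.log δ)
    (h2 : Real.log (1 + δ) ≤ Λ) {y : ℝ} (hy0 : 0 ≤ y) (hy1 : y ≤ 1) : |logTail δ y u| ≤ Λ := by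
  have h := hu.abs_logTail_sub_le hδ h1 h2 1 y
  have h0 : logTail δ 1 u = 0 := by simp [logTail]
  have hΛ : 0 ≤ Λ := by
    linarith [(hu.log_mem hδ 0).1, (hu.log_mem hδ 0).2]
  rw [h0, sub_zero, abs_of_nonpos (by linarith : y - 1 ≤ 0)] at h
  nlinarith

theorem abs_energy_le (hu : IsProfile u) (hδ : 0 < δ) {Λ : ℝ} (h1 : -Λ ≤ Real.log δ)
    (h2 : Real.log (1 + δ) ≤ Λ) : |energy δ u| ≤ 1 + δ * Λ := by
  have h := intervalIntegral.norm_integral_le_of_norm_le_const (a := (0 : ℝ)) (b := 1)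
    (f := fun z => u z - δ * Real.log (u z + δ)) (C := 1 + δ * Λ) fun z _ => by
      have := hu.log_mem hδ z
      rw [Real.norm_eq_abs, abs_le]
      constructor <;> nlinarith [hu.nonneg z, hu.le_one z]
  simpa [energy] using h

theorem intervalIntegrable_energy (hu : IsProfile u) (hδ : 0 < δ) (a b : ℝ) :
    IntervalIntegrable (fun z => u z - δ * Real.log (u z + δ)) volume a b :=
  (hu.intervalIntegrable a b).sub ((hu.intervalIntegrable_log hδ a b).const_mul δ)

/-- A pointwise bound on the increment of the slotwise potential integrates to a bound on
`energy - logTail`. -/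
theorem energy_sub_logTail_le (hu : IsProfile u) (hv : IsProfile v) (hδ : 0 < δ) {y ω : ℝ}
    (hy0 : 0 ≤ y) (hy1 : y ≤ 1) {f : ℝ → ℝ} (hf : IntervalIntegrable f volume 0 1)
    (h : ∀ z, 0 ≤ z → z ≤ 1 → ω * ((v z - u z) - (δ + if y < z then 1 else 0) *
      (Real.log (v z + δ) - Real.log (u z + δ))) ≤ f z) :
    ω * ((energy δ v - logTail δ y v) - (energy δ u - logTail δ y u)) ≤
      ∫ z in (0 : ℝ)..1, f z := by
  have hv1 := hv.intervalIntegrable_energy hδ 0 1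
  have hv2 := hv.intervalIntegrable_log_tail hδ y 0 1
  have hu1 := hu.intervalIntegrable_energy hδ 0 1
  have hu2 := hu.intervalIntegrable_log_tail hδ y 0 1
  rw [hu.logTail_eq hδ hy0 hy1, hv.logTail_eq hδ hy0 hy1, energy, energy,
    ← intervalIntegral.integral_sub hv1 hv2, ← intervalIntegral.integral_sub hu1 hu2,
    ← intervalIntegral.integral_sub (hv1.sub hv2) (hu1.sub hu2),
    ← intervalIntegral.integral_const_mul]
  refine intervalIntegral.integral_mono_on zero_le_one
    (((hv1.sub hv2).sub (hu1.sub hu2)).const_mul ω) hf fun z hz => ?_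
  refine le_trans (le_of_eq ?_) (h z hz.1 hz.2)
  split_ifs <;> ring

/-- A pointwise lower bound on the increment of the logarithms above `y` integrates to a bound on
`logTail`. -/
theorem le_logTail_sub (hu : IsProfile u) (hv : IsProfile v) (hδ : 0 < δ) {y ω : ℝ}
    (hy0 : 0 ≤ y) (hy1 : y ≤ 1) {f : ℝ → ℝ} (hf : IntervalIntegrable f volume 0 1)
    (h : ∀ z, 0 ≤ z → z ≤ 1 → f z ≤
      ω * if y < z then Real.log (v z + δ) - Real.log (u z + δ) else 0) :
    ∫ z in (0 : ℝ)..1, f z ≤ ω * (logTail δ y v - logTail δ y u) := by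
  have hv2 := hv.intervalIntegrable_log_tail hδ y 0 1
  have hu2 := hu.intervalIntegrable_log_tail hδ y 0 1
  rw [hu.logTail_eq hδ hy0 hy1, hv.logTail_eq hδ hy0 hy1, ← intervalIntegral.integral_sub hv2 hu2,
    ← intervalIntegral.integral_const_mul]
  refine intervalIntegral.integral_mono_on zero_le_one hf ((hv2.sub hu2).const_mul ω)
    fun z hz => ?_
  refine (h z hz.1 hz.2).trans (le_of_eq ?_)
  split_ifs <;> ring

theorem mass_sub (hu : IsProfile u) (hv : IsProfile v) :
    mass v - mass u = ∫ z in (0 : ℝ)..1, (v z - u z) := by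
  rw [intervalIntegral.integral_sub (hv.intervalIntegrable 0 1) (hu.intervalIntegrable 0 1)]
  rfl

theorem const {c : ℝ} (h0 : 0 ≤ c) (h1 : c ≤ 1) : IsProfile fun _ => c :=
  ⟨monotone_const, fun _ => h0, fun _ => h1⟩

end IsProfile

/-! ### Raising and lowering a profile -/

theorem sub_le_mul_log_sub {U V : ℝ} (hU : 0 < U) (hV : 0 < V) :
    V - U ≤ V * (Real.log V - Real.log U) := by
  have h := Real.log_le_sub_one_of_pos (div_pos hU hV)
  rw [Real.log_div hU.ne' hV.ne'] at h
  have h2 : V * (U / V - 1) = U - V := by field_simp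
  nlinarith [mul_le_mul_of_nonneg_left h hV.le]

theorem min_sub_eq_sub_max (τ a y : ℝ) : min τ (a - y) = a - max (a - τ) y := by
  rw [← min_sub_sub_left, sub_sub_cancel]

/-- Eviction: the missing fractions of the slots above `p`, shifted by `δ`, are multiplied by
`exp r`, and capped at `1`. -/
noncomputable def raise (δ r p : ℝ) (u : ℝ → ℝ) (z : ℝ) : ℝ :=
  if p < z then min 1 ((u z + δ) * Real.exp r - δ) else u z

/-- Answer to a request: the missing fractions of the slots up to `b`, shifted by `δ`, are
multiplied by `exp (-r)`, and truncated at `0`. -/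
noncomputable def lower (δ r b : ℝ) (u : ℝ → ℝ) (z : ℝ) : ℝ :=
  if z ≤ b then max 0 ((u z + δ) * Real.exp (-r) - δ) else u z

namespace IsProfile

variable {u v : ℝ → ℝ} {δ r p b : ℝ}

theorem le_raise (hu : IsProfile u) (hδ : 0 < δ) (hr : 0 ≤ r) (z : ℝ) :
    u z ≤ raise δ r p u z := by
  unfold raise
  split_ifs
  · refine le_min (hu.le_one z) ?_
    nlinarith [Real.one_le_exp hr, hu.nonneg z]
  · exact le_rfl

theorem raise_isProfile (hu : IsProfile u) (hδ : 0 < δ) (hr : 0 ≤ r) :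
    IsProfile (raise δ r p u) := by
  refine ⟨fun x y h => ?_, fun z => (hu.nonneg z).trans (hu.le_raise hδ hr z), fun z => ?_⟩
  · by_cases hx : p < x
    · have hy : p < y := hx.trans_le h
      simp only [raise, hx, hy, if_true]
      refine min_le_min le_rfl ?_
      have := hu.mono h
      nlinarith [Real.exp_pos r]
    · have : raise δ r p u x = u x := by simp [raise, hx]
      rw [this]
      exact (hu.mono h).trans (hu.le_raise hδ hr y)
  · unfold raise
    split_ifs
    · exact min_le_left _ _
    · exact hu.le_one z

theorem lower_le (hu : IsProfile u) (hδ : 0 < δ) (hr : 0 ≤ r) (z : ℝ) :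
    lower δ r b u z ≤ u z := by
  unfold lower
  split_ifs
  · refine max_le (hu.nonneg z) ?_
    have : Real.exp (-r) ≤ 1 := Real.exp_le_one_iff.2 (by linarith)
    nlinarith [hu.nonneg z]
  · exact le_rfl

theorem lower_isProfile (hu : IsProfile u) (hδ : 0 < δ) (hr : 0 ≤ r) :
    IsProfile (lower δ r b u) := by
  refine ⟨fun x y h => ?_, fun z => ?_, fun z => (hu.lower_le hδ hr z).trans (hu.le_one z)⟩
  · by_cases hy : y ≤ b
    · have hx : x ≤ b := h.trans hy
      simp only [lower, hx, hy, if_true]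
      refine max_le_max le_rfl ?_
      have := hu.mono h
      nlinarith [Real.exp_pos (-r)]
    · have : lower δ r b u y = u y := by simp [lower, hy]
      rw [this]
      exact (hu.lower_le hδ hr x).trans (hu.mono h)
  · unfold lower
    split_ifs
    · exact le_max_left _ _
    · exact hu.nonneg z

/-- A raised slot that is not saturated has its logarithm increased by exactly `r`; a saturated
slot by at most `r`. -/
theorem log_raise (hu : IsProfile u) (hδ : 0 < δ) (hr : 0 ≤ r) {z : ℝ} (hz : p < z) :
    Real.log (raise δ r p u z + δ) - Real.log (u z + δ) ≤ r ∧
      (raise δ r p u z < 1 → Real.log (raise δ r p u z + δ) - Real.log (u z + δ) = r) := by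
  have hU : 0 < u z + δ := by linarith [hu.nonneg z]
  have hV : 0 < raise δ r p u z + δ := by linarith [hu.nonneg z, hu.le_raise (p := p) hδ hr z]
  have hlog : Real.log ((u z + δ) * Real.exp r) = Real.log (u z + δ) + r := by
    rw [Real.log_mul hU.ne' (Real.exp_pos r).ne', Real.log_exp]
  have hdef : raise δ r p u z = min 1 ((u z + δ) * Real.exp r - δ) := by simp [raise, hz]
  constructor
  · have : raise δ r p u z + δ ≤ (u z + δ) * Real.exp r := by
      rw [hdef]
      linarith [min_le_right 1 ((u z + δ) * Real.exp r - δ)]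
    have := Real.log_le_log hV this
    linarith
  · intro hlt
    have : raise δ r p u z + δ = (u z + δ) * Real.exp r := by
      rw [hdef] at hlt ⊢
      rcases min_choice 1 ((u z + δ) * Real.exp r - δ) with h | h
      · rw [h] at hlt
        exact absurd hlt (lt_irrefl _)
      · rw [h]
        ring
    rw [this, hlog]
    ring

theorem raise_eq_one (hu : IsProfile u) (hδ : 0 < δ) (hr : 0 ≤ r) {z : ℝ} (h : u z = 1) :
    raise δ r p u z = 1 :=
  le_antisymm ((hu.raise_isProfile hδ hr).le_one z) (h ▸ hu.le_raise hδ hr z)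

section Raise

variable {ω τ y : ℝ}

/-- The effect of raising the top part of length `τ` of a profile on the service potential. The
subtracted length is the part of the raised interval that is empty offline: there the divergence
to the offline profile drops. -/
theorem energy_sub_logTail_raise (hu : IsProfile u) (hδ : 0 < δ) (hω : 0 < ω) (hr : 0 ≤ r)
    (hy0 : 0 ≤ y) (hy1 : y ≤ 1) :
    ω * ((energy δ (raise δ r (height u - τ) u) - logTail δ y (raise δ r (height u - τ) u)) -
      (energy δ u - logTail δ y u)) ≤
    ω * r * (mass (raise δ r (height u - τ) u) - (1 - height u) -
      max 0 (min τ (height u - y))) := by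
  set p := height u - τ with hp
  set v := raise δ r p u with hv
  have hvp : IsProfile v := hu.raise_isProfile hδ hr
  have ha0 := height_nonneg u
  have ha1 := hu.height_le_one
  have i1 := hvp.intervalIntegrable 0 1
  have i2 := (measurable_ite_lt (height u)
    (measurable_const (a := (1 : ℝ)))).intervalIntegrable_of_abs_le 1
      (fun z => by split_ifs <;> simp) 0 1
  have i3 := (measurable_ite_Ioc (max p y) (height u)).intervalIntegrable_of_abs_le 1
      (fun z => by split_ifs <;> simp) 0 1
  have key := hu.energy_sub_logTail_le hvp hδ (ω := ω) hy0 hy1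
    (f := fun z => ω * r * (v z - (if height u < z then 1 else 0) -
      if max p y < z ∧ z ≤ height u then 1 else 0))
    (((i1.sub i2).sub i3).const_mul _) (fun z hz0 hz1 => by
      rw [mul_assoc]
      refine mul_le_mul_of_nonneg_left ?_ hω.le
      have hvz0 := hvp.nonneg z
      have hvz1 := hvp.le_one z
      rcases lt_or_ge (height u) z with hz | hz
      · have h1 := hu.eq_one_of_height_lt hz0 hz1 hz
        have h2 : v z = 1 := hu.raise_eq_one hδ hr h1
        simp [h1, h2, hz, not_le.2 hz]
      · rcases lt_or_ge p z with hpz | hpz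
        · obtain ⟨h1, h2⟩ := hu.log_raise hδ hr hpz
          rw [← hv] at h1 h2
          have h0 : u z ≤ v z := hu.le_raise hδ hr z
          have hU : 0 < u z + δ := by linarith [hu.nonneg z]
          have hV : 0 < v z + δ := by linarith
          have h3 := sub_le_mul_log_sub hU hV
          have h4 := Real.log_le_log hU (by linarith : u z + δ ≤ v z + δ)
          simp only [not_lt.2 hz, if_false, sub_zero, hz, and_true, max_lt_iff, hpz, true_and]
          by_cases hyz : y < z
          · simp only [hyz, if_true]
            rcases hvz1.lt_or_eq with hlt | heq
            · rw [h2 hlt] at h3 ⊢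
              linarith
            · rw [heq] at h3 ⊢
              linarith
          · simp only [hyz, if_false]
            nlinarith
        · have h2 : v z = u z := by simp [hv, raise, not_lt.2 hpz]
          simp only [h2, sub_self, mul_zero, not_lt.2 hz, if_false, sub_zero, max_lt_iff,
            not_lt.2 hpz, false_and]
          exact mul_nonneg hr (hu.nonneg z))
  rw [intervalIntegral.integral_const_mul, intervalIntegral.integral_sub (i1.sub i2) i3,
    intervalIntegral.integral_sub i1 i2, integral_ite_lt _ ha0 ha1, integral_ite_Ioc,
    min_eq_left ha1, max_eq_left (hy0.trans (le_max_right p y))] at key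
  rw [min_sub_eq_sub_max, ← hp]
  exact key

/-- The mass gained by raising is at most `r` times the integral of `v + δ` over the raised part,
where `v` is the raised profile. Slots above the height contribute nothing to the gain. -/
theorem mass_raise_sub_le (hu : IsProfile u) (hδ : 0 < δ) (hω : 0 < ω) (hr : 0 ≤ r)
    (hτ : 0 ≤ τ) :
    ω * (mass (raise δ r (height u - τ) u) - mass u) ≤
      ω * r * (mass (raise δ r (height u - τ) u) - (1 - height u) + δ * τ) := by
  set p := height u - τ with hp
  set v := raise δ r p u with hv
  have hvp : IsProfile v := hu.raise_isProfile hδ hr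
  have ha0 := height_nonneg u
  have ha1 := hu.height_le_one
  have i1 := hvp.intervalIntegrable 0 1
  have i2 := (measurable_ite_lt (height u)
    (measurable_const (a := (1 : ℝ)))).intervalIntegrable_of_abs_le 1
      (fun z => by split_ifs <;> simp) 0 1
  have i3 := (measurable_ite_Ioc p (height u)).intervalIntegrable_of_abs_le 1
      (fun z => by split_ifs <;> simp) 0 1
  rw [hu.mass_sub hvp, mul_assoc]
  refine mul_le_mul_of_nonneg_left ?_ hω.le
  have key := intervalIntegral.integral_mono_on zero_le_one (i1.sub (hu.intervalIntegrable 0 1))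
    (((i1.sub i2).add (i3.const_mul δ)).const_mul r) (fun z hz => by
      have hvz0 := hvp.nonneg z
      rcases lt_or_ge (height u) z with hzh | hzh
      · have h1 := hu.eq_one_of_height_lt hz.1 hz.2 hzh
        have h2 : v z = 1 := hu.raise_eq_one hδ hr h1
        simp [h1, h2, hzh, not_le.2 hzh]
      · rcases lt_or_ge p z with hpz | hpz
        · obtain ⟨h1, -⟩ := hu.log_raise hδ hr hpz
          rw [← hv] at h1
          have h0 : u z ≤ v z := hu.le_raise hδ hr z
          have hU : 0 < u z + δ := by linarith [hu.nonneg z]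
          have hV : 0 < v z + δ := by linarith
          have h3 := sub_le_mul_log_sub hU hV
          simp only [not_lt.2 hzh, if_false, hzh, and_true, hpz, if_true]
          nlinarith
        · have h2 : v z = u z := by simp [hv, raise, not_lt.2 hpz]
          simp only [h2, sub_self, not_lt.2 hzh, if_false, not_lt.2 hpz, false_and, mul_zero,
            add_zero, sub_zero]
          exact mul_nonneg hr (hu.nonneg z))
  refine key.trans ?_
  rw [intervalIntegral.integral_const_mul, intervalIntegral.integral_add (i1.sub i2)
    (i3.const_mul δ), intervalIntegral.integral_sub i1 i2, integral_ite_lt _ ha0 ha1,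
    intervalIntegral.integral_const_mul, integral_ite_Ioc, min_eq_left ha1]
  refine mul_le_mul_of_nonneg_left (add_le_add le_rfl (mul_le_mul_of_nonneg_left ?_ hδ.le)) hr
  exact max_le hτ (by linarith [le_max_left p 0])

theorem height_sub_height_raise (hu : IsProfile u) (hv : IsProfile v) :
    height u - height v = ∫ z in (0 : ℝ)..1,
      ((if u z < 1 then (1 : ℝ) else 0) - if v z < 1 then 1 else 0) := by
  rw [intervalIntegral.integral_sub (hu.intervalIntegrable_lt_one 0 1)
    (hv.intervalIntegrable_lt_one 0 1)]
  rfl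

/-- The logarithm grows by `r` on every raised slot that is not saturated. The length of the newly
saturated slots is the decrease of the height, which is a telescoping loss. -/
theorem le_logTail_raise_sub (hu : IsProfile u) (hδ : 0 < δ) (hω : 0 < ω) (hr : 0 ≤ r)
    (hy0 : 0 ≤ y) (hy1 : y ≤ 1) :
    ω * r * (max 0 (min τ (height u - y)) -
      (height u - height (raise δ r (height u - τ) u))) ≤
    ω * (logTail δ y (raise δ r (height u - τ) u) - logTail δ y u) := by
  set p := height u - τ with hp
  set v := raise δ r p u with hv
  have hvp : IsProfile v := hu.raise_isProfile hδ hr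
  have ha0 := height_nonneg u
  have ha1 := hu.height_le_one
  have i1 := hu.intervalIntegrable_lt_one 0 1
  have i2 := hvp.intervalIntegrable_lt_one 0 1
  have i3 := (measurable_ite_Ioo (max p y) (height u)).intervalIntegrable_of_abs_le 1
      (fun z => by split_ifs <;> simp) 0 1
  have key := hu.le_logTail_sub hvp hδ (ω := ω) hy0 hy1
    (f := fun z => ω * r * ((if max p y < z ∧ z < height u then 1 else 0) -
      ((if u z < 1 then (1 : ℝ) else 0) - if v z < 1 then 1 else 0)))
    ((i3.sub (i1.sub i2)).const_mul _) (fun z hz0 hz1 => by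
      rw [mul_assoc]
      refine mul_le_mul_of_nonneg_left ?_ hω.le
      have h0 : u z ≤ v z := hu.le_raise hδ hr z
      have hU : 0 < u z + δ := by linarith [hu.nonneg z]
      have h4 := Real.log_le_log hU (by linarith : u z + δ ≤ v z + δ)
      have hL : 0 ≤ if y < z then Real.log (v z + δ) - Real.log (u z + δ) else 0 := by
        split_ifs
        · linarith
        · exact le_rfl
      by_cases hA : max p y < z ∧ z < height u
      · simp only [hA, and_self, if_true]
        obtain ⟨hpz, hyz⟩ := max_lt_iff.1 hA.1
        by_cases hv1 : v z < 1
        · have hu1 : u z < 1 := h0.trans_lt hv1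
          obtain ⟨-, h2⟩ := hu.log_raise hδ hr hpz
          rw [← hv] at h2
          simp [hv1, hu1, hyz, h2 hv1]
        · have hu1 : u z < 1 := hu.lt_one_of_lt_height hz0 hA.2
          simpa [hv1, hu1] using hL
      · simp only [hA, if_false]
        by_cases hv1 : v z < 1
        · have hu1 : u z < 1 := h0.trans_lt hv1
          simpa [hv1, hu1] using hL
        · simp only [hv1, if_false]
          split_ifs at hL ⊢ <;> nlinarith)
  rw [intervalIntegral.integral_const_mul, intervalIntegral.integral_sub i3 (i1.sub i2),
    ← hu.height_sub_height_raise hvp, integral_ite_Ioo,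
    min_eq_left ha1, max_eq_left (hy0.trans (le_max_right p y))] at key
  rw [min_sub_eq_sub_max, ← hp]
  exact key

/-- Every slot of the raised part either gains a fixed amount or becomes saturated. -/
theorem progress_raise (hu : IsProfile u) (hδ : 0 < δ) (hr : 0 ≤ r) {κ : ℝ} (hκ0 : 0 ≤ κ)
    (hκ : κ ≤ δ * r) :
    κ * max 0 (min τ (height u)) ≤ (mass (raise δ r (height u - τ) u) - mass u) +
      κ * (height u - height (raise δ r (height u - τ) u)) := by
  set p := height u - τ with hp
  set v := raise δ r p u with hv
  have hvp : IsProfile v := hu.raise_isProfile hδ hr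
  have ha1 := hu.height_le_one
  have i0 := (hvp.intervalIntegrable 0 1).sub (hu.intervalIntegrable 0 1)
  have i1 := hu.intervalIntegrable_lt_one 0 1
  have i2 := hvp.intervalIntegrable_lt_one 0 1
  have i3 := (measurable_ite_Ioo p (height u)).intervalIntegrable_of_abs_le 1
      (fun z => by split_ifs <;> simp) 0 1
  have key := intervalIntegral.integral_mono_on zero_le_one (i3.const_mul κ)
    (i0.add ((i1.sub i2).const_mul κ)) (fun z hz => by
      have h0 : u z ≤ v z := hu.le_raise hδ hr z
      by_cases hA : p < z ∧ z < height u
      · simp only [hA, and_self, if_true]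
        have hu1 : u z < 1 := hu.lt_one_of_lt_height hz.1 hA.2
        by_cases hv1 : v z < 1
        · have h1 : v z = (u z + δ) * Real.exp r - δ := by
            rw [hv, raise, if_pos hA.1] at hv1 ⊢
            rcases min_choice 1 ((u z + δ) * Real.exp r - δ) with h | h
            · rw [h] at hv1
              exact absurd hv1 (lt_irrefl _)
            · exact h
          have h2 : κ ≤ v z - u z := by
            rw [h1]
            nlinarith [Real.add_one_le_exp r, hu.nonneg z]
          simp only [hv1, hu1, if_true]
          linarith
        · simp only [hv1, hu1, if_true, if_false]
          linarith
      · simp only [hA, if_false, mul_zero]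
        by_cases hv1 : v z < 1
        · have hu1 : u z < 1 := h0.trans_lt hv1
          simp only [hv1, hu1, if_true]
          linarith
        · simp only [hv1, if_false]
          have : 0 ≤ κ * (if u z < 1 then (1 : ℝ) else 0) := by positivity
          linarith)
  rw [intervalIntegral.integral_add i0 ((i1.sub i2).const_mul κ),
    intervalIntegral.integral_const_mul, intervalIntegral.integral_const_mul,
    ← hu.mass_sub hvp, ← hu.height_sub_height_raise hvp, integral_ite_Ioo, min_eq_left ha1] at key
  have h5 := min_sub_eq_sub_max τ (height u) 0
  rw [sub_zero] at h5
  rw [h5]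
  exact key

theorem mass_raise_le (hu : IsProfile u) (hδ : 0 < δ) (hr : 0 ≤ r) :
    mass (raise δ r p u) - mass u ≤ (1 + δ) * (Real.exp r - 1) := by
  have hvp : IsProfile (raise δ r p u) := hu.raise_isProfile hδ hr
  have h0 : 0 ≤ Real.exp r - 1 := by linarith [Real.one_le_exp hr]
  rw [hu.mass_sub hvp]
  have key := intervalIntegral.integral_mono_on zero_le_one
    ((hvp.intervalIntegrable 0 1).sub (hu.intervalIntegrable 0 1))
    (intervalIntegrable_const (c := (1 + δ) * (Real.exp r - 1))) (fun z _ => by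
      have := hu.le_one z
      unfold raise
      split_ifs
      · have := min_le_right 1 ((u z + δ) * Real.exp r - δ)
        nlinarith
      · rw [sub_self]
        positivity)
  simpa using key

end Raise

section Lower

variable {ω y : ℝ}

/-- A lowered slot that is not emptied has its logarithm decreased by exactly `r`; an emptied slot
by at most `r`. -/
theorem log_lower (hu : IsProfile u) (hδ : 0 < δ) {z : ℝ} (hz : z ≤ b) :
    -r ≤ Real.log (lower δ r b u z + δ) - Real.log (u z + δ) ∧
      (0 < lower δ r b u z →
        Real.log (lower δ r b u z + δ) - Real.log (u z + δ) = -r) := by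
  have hU : 0 < u z + δ := by linarith [hu.nonneg z]
  have hW : 0 < (u z + δ) * Real.exp (-r) := mul_pos hU (Real.exp_pos _)
  have hlog : Real.log ((u z + δ) * Real.exp (-r)) = Real.log (u z + δ) - r := by
    rw [Real.log_mul hU.ne' (Real.exp_pos _).ne', Real.log_exp]
    ring
  have hdef : lower δ r b u z = max 0 ((u z + δ) * Real.exp (-r) - δ) := by simp [lower, hz]
  constructor
  · have : (u z + δ) * Real.exp (-r) ≤ lower δ r b u z + δ := by
      rw [hdef]
      linarith [le_max_right 0 ((u z + δ) * Real.exp (-r) - δ)]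
    have := Real.log_le_log hW this
    linarith
  · intro hlt
    have : lower δ r b u z + δ = (u z + δ) * Real.exp (-r) := by
      rw [hdef] at hlt ⊢
      rcases max_choice 0 ((u z + δ) * Real.exp (-r) - δ) with h | h
      · rw [h] at hlt
        exact absurd hlt (lt_irrefl _)
      · rw [h]
        ring
    rw [this, hlog]
    ring

theorem sub_lower_le (hu : IsProfile u) (hδ : 0 < δ) (hr : 0 ≤ r) (z : ℝ) :
    u z - lower δ r b u z ≤ (1 + δ) * r := by
  have h1 := hu.le_one z
  have h0 := hu.nonneg z
  unfold lower
  split_ifs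
  · have h2 := le_max_right 0 ((u z + δ) * Real.exp (-r) - δ)
    nlinarith [Real.add_one_le_exp (-r)]
  · rw [sub_self]
    positivity

/-- The effect of a request on the service potential: up to a term of second order it pays for
the difference of the online and the offline service cost of the hinge `x ↦ max 0 (b - x)`. -/
theorem energy_sub_logTail_lower (hu : IsProfile u) (hδ : 0 < δ) (hω : 0 < ω) (hr : 0 ≤ r)
    (hb0 : 0 ≤ b) (hb1 : b ≤ 1) (hy0 : 0 ≤ y) (hy1 : y ≤ 1) :
    ω * ((energy δ (lower δ r b u) - logTail δ y (lower δ r b u)) -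
      (energy δ u - logTail δ y u)) ≤
    ω * r * (max 0 (b - y) - (b - (1 - mass u)) + (1 + δ) * r) := by
  set v := lower δ r b u with hv
  have hvp : IsProfile v := hu.lower_isProfile hδ hr
  have i1 := hu.intervalIntegrable 0 1
  have i2 := (measurable_ite_lt b
    (measurable_const (a := (1 : ℝ)))).intervalIntegrable_of_abs_le 1
      (fun z => by split_ifs <;> simp) 0 1
  have i3 := (measurable_ite_Ioc y b).intervalIntegrable_of_abs_le 1
      (fun z => by split_ifs <;> simp) 0 1
  have i4 : IntervalIntegrable (fun _ : ℝ => (1 + δ) * r) volume 0 1 := intervalIntegrable_const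
  have key := hu.energy_sub_logTail_le hvp hδ (ω := ω) hy0 hy1
    (f := fun z => ω * r * ((if y < z ∧ z ≤ b then 1 else 0) - u z +
      (if b < z then 1 else 0) + (1 + δ) * r))
    ((((i3.sub i1).add i2).add i4).const_mul _) (fun z hz0 hz1 => by
      rw [mul_assoc]
      refine mul_le_mul_of_nonneg_left ?_ hω.le
      have hvz0 := hvp.nonneg z
      rcases lt_or_ge b z with hz | hz
      · have h2 : v z = u z := by simp [hv, lower, not_le.2 hz]
        simp only [h2, sub_self, mul_zero, hz, if_true, not_le.2 hz, and_false, if_false]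
        have := hu.le_one z
        have : 0 ≤ (1 + δ) * r := by positivity
        exact mul_nonneg hr (by linarith)
      · obtain ⟨h1, h2⟩ := hu.log_lower (r := r) hδ hz
        rw [← hv] at h1 h2
        have h0 : v z ≤ u z := hu.lower_le hδ hr z
        have hU : 0 < u z + δ := by linarith [hu.nonneg z]
        have hV : 0 < v z + δ := by linarith
        have h3 := sub_le_mul_log_sub hU hV
        have h4 := Real.log_le_log hV (by linarith : v z + δ ≤ u z + δ)
        have h5 : u z - v z ≤ (1 + δ) * r := hu.sub_lower_le hδ hr z
        simp only [hz, and_true, not_lt.2 hz, if_false, add_zero]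
        rcases hvz0.lt_or_eq with hlt | heq
        · have h6 := h2 hlt
          rw [h6] at h3 ⊢
          by_cases hyz : y < z
          · simp only [hyz, if_true]
            nlinarith
          · simp only [hyz, if_false]
            nlinarith
        · rw [← heq] at h3 h5 h4 h1 ⊢
          by_cases hyz : y < z
          · simp only [hyz, if_true]
            nlinarith
          · simp only [hyz, if_false]
            nlinarith)
  rw [intervalIntegral.integral_const_mul, intervalIntegral.integral_add ((i3.sub i1).add i2) i4,
    intervalIntegral.integral_add (i3.sub i1) i2, intervalIntegral.integral_sub i3 i1,
    integral_ite_lt _ hb0 hb1, integral_ite_Ioc, min_eq_left hb1, max_eq_left hy0,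
    intervalIntegral.integral_const] at key
  refine key.trans (le_of_eq ?_)
  simp only [mass, sub_zero, one_smul]
  ring

/-- A request lowers the logarithmic tail by at most the offline service cost of the hinge. -/
theorem le_logTail_lower_sub (hu : IsProfile u) (hδ : 0 < δ) (hω : 0 < ω) (hr : 0 ≤ r)
    (hb1 : b ≤ 1) (hy0 : 0 ≤ y) (hy1 : y ≤ 1) :
    -(ω * r * max 0 (b - y)) ≤ ω * (logTail δ y (lower δ r b u) - logTail δ y u) := by
  have hvp : IsProfile (lower δ r b u) := hu.lower_isProfile hδ hr
  have i3 := (measurable_ite_Ioc y b).intervalIntegrable_of_abs_le 1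
      (fun z => by split_ifs <;> simp) 0 1
  have key := hu.le_logTail_sub hvp hδ (ω := ω) hy0 hy1
    (f := fun z => -(ω * r) * (if y < z ∧ z ≤ b then 1 else 0)) (i3.const_mul _)
    (fun z _ _ => by
      rw [neg_mul, mul_assoc, ← mul_neg]
      refine mul_le_mul_of_nonneg_left ?_ hω.le
      by_cases hz : z ≤ b
      · have h1 := (hu.log_lower (r := r) hδ hz).1
        by_cases hyz : y < z
        · simpa [hyz, hz] using h1
        · simp [hyz]
      · simp [hz, lower])
  rw [intervalIntegral.integral_const_mul, integral_ite_Ioc, min_eq_left hb1,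
    max_eq_left hy0] at key
  linarith

end Lower

end IsProfile

/-! ### Potentials and eviction -/

/-- For heights `a` of total `1 + τ` and an allocation `y`, the parts of the top intervals
`(a i - τ, a i]` that lie above `y i` have total length at least `τ`. -/
theorem le_sum_max_min {ι : Type*} [Fintype ι] {a y : ι → ℝ} {τ : ℝ} (hτ : 0 ≤ τ)
    (h : ∑ i, a i - ∑ i, y i = τ) : τ ≤ ∑ i, max 0 (min τ (a i - y i)) := by
  by_cases hex : ∃ i, τ ≤ a i - y i
  · obtain ⟨i, hi⟩ := hex
    calc τ = max 0 (min τ (a i - y i)) := by rw [min_eq_left hi, max_eq_right hτ]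
      _ ≤ _ := Finset.single_le_sum (f := fun i => max 0 (min τ (a i - y i)))
        (fun j _ => le_max_left _ _) (Finset.mem_univ i)
  · push Not at hex
    calc τ = ∑ i, (a i - y i) := by rw [Finset.sum_sub_distrib, h]
      _ ≤ _ := Finset.sum_le_sum fun i _ => by
        rw [min_eq_right (hex i).le]
        exact le_max_right _ _

section Potentials

variable {M : Type*} [Fintype M]

/-- The potential that pays for the service cost: up to terms that do not depend on the profiles
it is the Bregman divergence, for the entropic regularizer with weights `ω` and shift `δ`, from the
current profiles to the profiles of the offline allocation `y`. -/
noncomputable def servicePot (δ : ℝ) (ω y : M → ℝ) (u : M → ℝ → ℝ) : ℝ :=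
  ∑ i, ω i * (energy δ (u i) - logTail δ (y i) (u i))

/-- The weighted sum of the logarithmic tails above the offline allocation. -/
noncomputable def tailPot (δ : ℝ) (ω y : M → ℝ) (u : M → ℝ → ℝ) : ℝ :=
  ∑ i, ω i * logTail δ (y i) (u i)

/-- The potential that pays for the movement cost. Increases of the mass cost at most twice the
growth of the tail potential; decreases are balanced by increases up to the change of the mass,
which gives the factor `4` and the first term. -/
noncomputable def movePot (δ : ℝ) (ω y : M → ℝ) (u : M → ℝ → ℝ) : ℝ :=
  ∑ i, ω i * mass (u i) - 4 * tailPot δ ω y u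

variable {ω : M → ℝ} {δ : ℝ} {u : M → ℝ → ℝ}

/-- The effect of raising, at every point, the top part of length `τ`, where `1 + τ` is the total
height. The service potential does not grow, and the tail potential grows enough to pay for the
movement, up to the amount of newly saturated slots. -/
theorem raise_all (hω : ∀ i, 0 < ω i) (hδ : 0 < δ) (hδn : δ * Fintype.card M ≤ 1)
    (hu : ∀ i, IsProfile (u i))
    {t τ : ℝ} (ht : 0 ≤ t) (hτ0 : 0 ≤ τ) (hτ : ∑ i, height (u i) - 1 = τ) {v : M → ℝ → ℝ}
    (hv : v = fun i => raise δ (t / ω i) (height (u i) - τ) (u i))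
    (hmass : ∑ i, mass (v i) ≤ Fintype.card M - 1) :
    (∀ y ∈ stdSimplex ℝ M, servicePot δ ω y v ≤ servicePot δ ω y u ∧
      ∑ i, ω i * (mass (v i) - mass (u i)) ≤ 2 * (tailPot δ ω y v - tailPot δ ω y u) +
        2 * t * (∑ i, height (u i) - ∑ i, height (v i))) ∧
    ∀ κ : ℝ, 0 ≤ κ → (∀ i, κ ≤ δ * (t / ω i)) → κ * τ ≤
      (∑ i, mass (v i) - ∑ i, mass (u i)) +
        κ * (∑ i, height (u i) - ∑ i, height (v i)) := by
  have hr : ∀ i, 0 ≤ t / ω i := fun i => div_nonneg ht (hω i).le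
  have hωr : ∀ i, ω i * (t / ω i) = t := fun i => by
    have := (hω i).ne'
    field_simp
  have hsum : ∑ i, (mass (v i) - (1 - height (u i))) ≤ τ := by
    rw [Finset.sum_sub_distrib, Finset.sum_sub_distrib]
    simp only [Finset.sum_const, Finset.card_univ, nsmul_eq_mul, mul_one]
    linarith
  refine ⟨fun y hy => ?_, fun κ hκ0 hκ => ?_⟩
  · have hy1 : ∀ i, y i ≤ 1 := fun i => (mem_Icc_of_mem_stdSimplex hy i).2
    have hA : τ ≤ ∑ i, max 0 (min τ (height (u i) - y i)) := le_sum_max_min hτ0 (by rw [hy.2, hτ])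
    constructor
    · have key : servicePot δ ω y v - servicePot δ ω y u ≤
          ∑ i, t * (mass (v i) - (1 - height (u i)) - max 0 (min τ (height (u i) - y i))) := by
        rw [servicePot, servicePot, ← Finset.sum_sub_distrib]
        refine Finset.sum_le_sum fun i _ => ?_
        have := (hu i).energy_sub_logTail_raise (τ := τ) hδ (hω i) (hr i) (hy.1 i) (hy1 i)
        rw [hωr] at this
        rw [← mul_sub, hv]
        exact this
      rw [← Finset.mul_sum, Finset.sum_sub_distrib] at key
      nlinarith [mul_le_mul_of_nonneg_left (hsum.trans hA) ht]
    · have h1 : ∑ i, ω i * (mass (v i) - mass (u i)) ≤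
          ∑ i, t * (mass (v i) - (1 - height (u i)) + δ * τ) := by
        refine Finset.sum_le_sum fun i _ => ?_
        have := (hu i).mass_raise_sub_le (τ := τ) hδ (hω i) (hr i) hτ0
        rw [hωr] at this
        rw [hv]
        exact this
      rw [← Finset.mul_sum, Finset.sum_add_distrib, Finset.sum_const, Finset.card_univ,
        nsmul_eq_mul] at h1
      have h2 : ∑ i, t * (max 0 (min τ (height (u i) - y i)) -
          (height (u i) - height (v i))) ≤ tailPot δ ω y v - tailPot δ ω y u := by
        rw [tailPot, tailPot, ← Finset.sum_sub_distrib]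
        refine Finset.sum_le_sum fun i _ => ?_
        have := (hu i).le_logTail_raise_sub (τ := τ) hδ (hω i) (hr i) (hy.1 i) (hy1 i)
        rw [hωr] at this
        rw [← mul_sub, hv]
        exact this
      rw [← Finset.mul_sum, Finset.sum_sub_distrib, Finset.sum_sub_distrib] at h2
      have h3 : (Fintype.card M : ℝ) * (δ * τ) ≤ τ := by nlinarith
      have h4 := mul_le_mul_of_nonneg_left (add_le_add hsum h3) ht
      have h5 := mul_le_mul_of_nonneg_left hA ht
      nlinarith
  · have hA : τ ≤ ∑ i, max 0 (min τ (height (u i))) := by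
      by_cases hM : Nonempty M
      · obtain ⟨i₀⟩ := hM
        -- the lengths only grow when the allocation concentrated at `i₀` is replaced by `0`
        classical
        refine (le_sum_max_min (a := fun i => height (u i)) (y := Pi.single i₀ 1) hτ0
          (by simpa using hτ)).trans (Finset.sum_le_sum fun i _ =>
            max_le_max le_rfl (min_le_min le_rfl ?_))
        have : (0 : ℝ) ≤ (Pi.single i₀ 1 : M → ℝ) i := by
          rw [Pi.single_apply]
          positivity
        linarith
      · have := not_nonempty_iff.1 hM
        simp at hτ
        linarith
    have key : ∑ i, κ * max 0 (min τ (height (u i))) ≤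
        ∑ i, ((mass (v i) - mass (u i)) + κ * (height (u i) - height (v i))) := by
      refine Finset.sum_le_sum fun i _ => ?_
      rw [hv]
      exact (hu i).progress_raise hδ (hr i) hκ0 (hκ i)
    rw [← Finset.mul_sum, Finset.sum_add_distrib, ← Finset.mul_sum, Finset.sum_sub_distrib,
      Finset.sum_sub_distrib] at key
    exact (mul_le_mul_of_nonneg_left hA hκ0).trans key

theorem sum_height_ge (hu : ∀ i, IsProfile (u i)) :
    Fintype.card M - ∑ i, mass (u i) ≤ ∑ i, height (u i) := by
  have := Finset.sum_le_sum fun i (_ : i ∈ Finset.univ) => (hu i).one_sub_height_le_mass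
  rw [Finset.sum_sub_distrib] at this
  simp only [Finset.sum_const, Finset.card_univ, nsmul_eq_mul, mul_one] at this
  linarith

/-- Raising in small steps until the deficit is below `ρ`. The quantity
`∑ mass - κ * ∑ height` grows by a fixed amount in each step, and it is bounded. -/
theorem exists_raise_near (hω : ∀ i, 0 < ω i) (hδ : 0 < δ) (hδn : δ * Fintype.card M ≤ 1)
    {t ρ κ : ℝ} (ht : 0 ≤ t) (hρ : 0 < ρ) (hκ0 : 0 ≤ κ) (hκ : ∀ i, κ ≤ δ * (t / ω i))
    (hsmall : ∑ i, (1 + δ) * (Real.exp (t / ω i) - 1) ≤ ρ) (k : ℕ) :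
    ∀ u : M → ℝ → ℝ, (∀ i, IsProfile (u i)) → ∑ i, mass (u i) ≤ Fintype.card M - 1 →
      Fintype.card M - (∑ i, mass (u i) - κ * ∑ i, height (u i)) ≤ k * (κ * ρ) →
      ∃ v : M → ℝ → ℝ, (∀ i, IsProfile (v i)) ∧ (∀ i, mass (u i) ≤ mass (v i)) ∧
        ∑ i, mass (v i) ≤ Fintype.card M - 1 ∧ Fintype.card M - 1 - ρ < ∑ i, mass (v i) ∧
        ∀ y ∈ stdSimplex ℝ M, servicePot δ ω y v ≤ servicePot δ ω y u ∧
          ∑ i, ω i * (mass (v i) - mass (u i)) ≤ 2 * (tailPot δ ω y v - tailPot δ ω y u) +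
            2 * t * (∑ i, height (u i) - ∑ i, height (v i)) := by
  induction k with
  | zero =>
    intro u hu hm hk
    have : 0 ≤ ∑ i, height (u i) := Finset.sum_nonneg fun i _ => IsProfile.height_nonneg _
    have := mul_nonneg hκ0 this
    push_cast at hk
    linarith
  | succ k ih =>
    intro u hu hm hk
    by_cases hdone : Fintype.card M - 1 - ρ < ∑ i, mass (u i)
    · exact ⟨u, hu, fun i => le_rfl, hm, hdone, fun y _ => ⟨le_rfl, by simp⟩⟩
    have hr : ∀ i, 0 ≤ t / ω i := fun i => div_nonneg ht (hω i).le
    set τ := ∑ i, height (u i) - 1 with hτ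
    have hτρ : ρ ≤ τ := by linarith [sum_height_ge hu, not_lt.1 hdone]
    set w : M → ℝ → ℝ := fun i => raise δ (t / ω i) (height (u i) - τ) (u i) with hw
    have hwp : ∀ i, IsProfile (w i) := fun i => (hu i).raise_isProfile hδ (hr i)
    have hwm : ∑ i, mass (w i) ≤ Fintype.card M - 1 := by
      have : ∑ i, (mass (w i) - mass (u i)) ≤ ρ :=
        (Finset.sum_le_sum fun i _ => (hu i).mass_raise_le hδ (hr i)).trans hsmall
      rw [Finset.sum_sub_distrib] at this
      linarith [not_lt.1 hdone]
    obtain ⟨h1, h2⟩ := raise_all hω hδ hδn hu ht (hρ.le.trans hτρ) hτ.symm hw hwm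
    have h3 := h2 κ hκ0 hκ
    have h4 := mul_le_mul_of_nonneg_left hτρ hκ0
    obtain ⟨v, hv, hwv, hvm, hvm', hvy⟩ := ih w hwp hwm (by push_cast at hk; nlinarith)
    refine ⟨v, hv, fun i => le_trans ?_ (hwv i), hvm, hvm', fun y hy => ?_⟩
    · exact (hu i).mass_mono (hwp i) ((hu i).le_raise hδ (hr i))
    · obtain ⟨h5, h6⟩ := h1 y hy
      obtain ⟨h7, h8⟩ := hvy y hy
      refine ⟨h7.trans h5, ?_⟩
      have h9 : ∑ i, ω i * (mass (v i) - mass (u i)) =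
          ∑ i, ω i * (mass (v i) - mass (w i)) + ∑ i, ω i * (mass (w i) - mass (u i)) := by
        rw [← Finset.sum_add_distrib]
        exact Finset.sum_congr rfl fun i _ => by ring
      linarith

/-- Moving a profile towards the constant `1` by a fraction `θ`. -/
theorem IsProfile.fill {u : ℝ → ℝ} (hu : IsProfile u) {θ : ℝ} (h0 : 0 ≤ θ) (h1 : θ ≤ 1) :
    IsProfile (fun z => u z + θ * (1 - u z)) ∧ (∀ z, u z ≤ u z + θ * (1 - u z)) ∧
      mass (fun z => u z + θ * (1 - u z)) = mass u + θ * (1 - mass u) := by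
  refine ⟨⟨fun x y h => ?_, fun z => ?_, fun z => ?_⟩, fun z => ?_, ?_⟩
  · have := hu.mono h
    nlinarith
  · nlinarith [hu.nonneg z, hu.le_one z]
  · nlinarith [hu.nonneg z, hu.le_one z]
  · nlinarith [hu.nonneg z, hu.le_one z]
  · have i1 := hu.intervalIntegrable 0 1
    rw [mass, intervalIntegral.integral_add i1
      ((intervalIntegrable_const.sub i1).const_mul θ), intervalIntegral.integral_const_mul,
      intervalIntegral.integral_sub intervalIntegrable_const i1]
    simp [mass]

/-- Increasing a profile increases the slotwise service potential by at most the increase of the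
mass. -/
theorem IsProfile.energy_sub_logTail_le_mass {u v : ℝ → ℝ} (hu : IsProfile u) (hv : IsProfile v)
    (hδ : 0 < δ) {y ω : ℝ} (hω : 0 ≤ ω) (hy0 : 0 ≤ y) (hy1 : y ≤ 1) (h : ∀ z, u z ≤ v z) :
    ω * ((energy δ v - logTail δ y v) - (energy δ u - logTail δ y u)) ≤
      ω * (mass v - mass u) := by
  have i1 := (hv.intervalIntegrable 0 1).sub (hu.intervalIntegrable 0 1)
  have := hu.energy_sub_logTail_le hv hδ hy0 hy1 (i1.const_mul ω) (fun z _ _ => by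
    refine mul_le_mul_of_nonneg_left ?_ hω
    have h4 := Real.log_le_log (by linarith [hu.nonneg z] : 0 < u z + δ)
      (by linarith [h z] : u z + δ ≤ v z + δ)
    have : 0 ≤ δ + if y < z then (1 : ℝ) else 0 := by positivity
    nlinarith)
  rwa [intervalIntegral.integral_const_mul, ← hu.mass_sub hv] at this

/-- Profiles that miss too little in total can be raised to any allocation of the resource at no
service cost, with a movement cost that is paid by the tail potential. -/
theorem exists_raise [Nonempty M] (hω : ∀ i, 0 < ω i) (hδ : 0 < δ)
    (hδn : δ * Fintype.card M ≤ 1)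
    (hu : ∀ i, IsProfile (u i)) (hm : ∑ i, mass (u i) ≤ Fintype.card M - 1)
    {e : ℝ} (he : 0 < e) :
    ∃ v : M → ℝ → ℝ, (∀ i, IsProfile (v i)) ∧ (∀ i, mass (u i) ≤ mass (v i)) ∧
      ∑ i, mass (v i) = Fintype.card M - 1 ∧
      ∀ y ∈ stdSimplex ℝ M, servicePot δ ω y v ≤ servicePot δ ω y u + e ∧
        ∑ i, ω i * (mass (v i) - mass (u i)) ≤
          2 * (tailPot δ ω y v - tailPot δ ω y u) + e := by
  set n : ℝ := (Fintype.card M : ℝ) with hn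
  have hn1 : 1 ≤ n := by
    rw [hn]
    exact_mod_cast Fintype.card_pos
  set Ω := ∑ i, ω i with hΩ
  have hωΩ : ∀ i, ω i ≤ Ω := fun i =>
    Finset.single_le_sum (fun j _ => (hω j).le) (Finset.mem_univ i)
  have hΩ0 : 0 < Ω := Finset.sum_pos (fun i _ => hω i) Finset.univ_nonempty
  set ρ := e / (2 * Ω) with hρ
  have hρ0 : 0 < ρ := by positivity
  -- small steps: the saturation loss is at most `2 * t * n`, and no step overshoots `ρ`
  obtain ⟨t, ht0, ht1, ht2⟩ : ∃ t : ℝ, 0 < t ∧ 2 * t * n ≤ e / 2 ∧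
      ∑ i, (1 + δ) * (Real.exp (t / ω i) - 1) ≤ ρ := by
    have hc : Continuous fun t : ℝ => ∑ i, (1 + δ) * (Real.exp (t / ω i) - 1) := by fun_prop
    have h1 : ∀ᶠ t in nhds (0 : ℝ), ∑ i, (1 + δ) * (Real.exp (t / ω i) - 1) < ρ :=
      hc.continuousAt.eventually_lt continuousAt_const (by simpa using hρ0)
    have hc2 : Continuous fun t : ℝ => 2 * t * n := by fun_prop
    have h2 : ∀ᶠ t in nhds (0 : ℝ), 2 * t * n < e / 2 :=
      hc2.continuousAt.eventually_lt continuousAt_const (by simpa using he)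
    obtain ⟨t, ⟨h3, h4⟩, h5⟩ := (((h1.and h2).filter_mono nhdsWithin_le_nhds).and
      (self_mem_nhdsWithin (s := Set.Ioi (0 : ℝ)))).exists
    exact ⟨t, h5, h4.le, h3.le⟩
  have hκ : ∀ i, δ * (t / Ω) ≤ δ * (t / ω i) := fun i =>
    mul_le_mul_of_nonneg_left (div_le_div_of_nonneg_left ht0.le (hω i) (hωΩ i)) hδ.le
  have hκ0 : 0 < δ * (t / Ω) := by positivity
  obtain ⟨k, hk⟩ := exists_nat_ge
    ((n - (∑ i, mass (u i) - δ * (t / Ω) * ∑ i, height (u i))) / (δ * (t / Ω) * ρ))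
  rw [div_le_iff₀ (by positivity)] at hk
  obtain ⟨w, hw, huw, hwm, hwm', hwy⟩ :=
    exists_raise_near hω hδ hδn ht0.le hρ0 hκ0.le hκ ht2 k u hu hm hk
  -- the remaining deficit `m < ρ` is removed by filling every profile up by the same fraction
  set m := n - 1 - ∑ i, mass (w i) with hmdef
  have hm0 : 0 ≤ m := by linarith
  have hθ0 : 0 ≤ m / (1 + m) := by positivity
  have hθ1 : m / (1 + m) ≤ 1 := (div_le_one (by linarith)).2 (by linarith)
  have hfill := fun i => (hw i).fill hθ0 hθ1
  set v : M → ℝ → ℝ := fun i z => w i z + m / (1 + m) * (1 - w i z) with hv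
  have hmv : ∀ i, mass (v i) - mass (w i) = m / (1 + m) * (1 - mass (w i)) := fun i => by
    rw [hv, (hfill i).2.2]
    ring
  have hmv0 : ∀ i, 0 ≤ mass (v i) - mass (w i) := fun i => by
    rw [hmv]
    exact mul_nonneg hθ0 (by linarith [(hw i).mass_le_one])
  have hsum : ∑ i, (mass (v i) - mass (w i)) = m := by
    simp_rw [hmv]
    rw [← Finset.mul_sum, Finset.sum_sub_distrib]
    simp only [Finset.sum_const, Finset.card_univ, nsmul_eq_mul, mul_one]
    rw [← hn, show n - ∑ i, mass (w i) = 1 + m by rw [hmdef]; ring]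
    field_simp
  have hωsum : ∑ i, ω i * (mass (v i) - mass (w i)) ≤ e / 2 := by
    calc _ ≤ ∑ i, Ω * (mass (v i) - mass (w i)) :=
        Finset.sum_le_sum fun i _ => mul_le_mul_of_nonneg_right (hωΩ i) (hmv0 i)
      _ = Ω * m := by rw [← Finset.mul_sum, hsum]
      _ ≤ Ω * ρ := mul_le_mul_of_nonneg_left (by linarith) hΩ0.le
      _ = e / 2 := by
        rw [hρ]
        field_simp
  have hheight : ∑ i, height (u i) - ∑ i, height (w i) ≤ n := by
    have h1 : ∑ i, height (u i) ≤ n := by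
      have := Finset.sum_le_sum fun i (_ : i ∈ Finset.univ) => (hu i).height_le_one
      simpa using this
    have h2 : 0 ≤ ∑ i, height (w i) := Finset.sum_nonneg fun i _ => IsProfile.height_nonneg _
    linarith
  refine ⟨v, fun i => (hfill i).1, fun i => by linarith [huw i, hmv0 i], ?_, fun y hy => ?_⟩
  · rw [Finset.sum_sub_distrib] at hsum
    linarith
  · have hy1 : ∀ i, y i ≤ 1 := fun i => (mem_Icc_of_mem_stdSimplex hy i).2
    obtain ⟨h1, h2⟩ := hwy y hy
    constructor
    · have h3 : servicePot δ ω y v - servicePot δ ω y w ≤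
          ∑ i, ω i * (mass (v i) - mass (w i)) := by
        rw [servicePot, servicePot, ← Finset.sum_sub_distrib]
        refine Finset.sum_le_sum fun i _ => ?_
        rw [← mul_sub]
        exact (hw i).energy_sub_logTail_le_mass (hfill i).1 hδ (hω i).le (hy.1 i) (hy1 i)
          (hfill i).2.1
      linarith
    · have h3 : tailPot δ ω y w ≤ tailPot δ ω y v :=
        Finset.sum_le_sum fun i _ => mul_le_mul_of_nonneg_left
          ((hw i).logTail_mono (hfill i).1 hδ (hy1 i) (hfill i).2.1) (hω i).le
      have h4 : ∑ i, ω i * (mass (v i) - mass (u i)) =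
          ∑ i, ω i * (mass (v i) - mass (w i)) + ∑ i, ω i * (mass (w i) - mass (u i)) := by
        rw [← Finset.sum_add_distrib]
        exact Finset.sum_congr rfl fun i _ => by ring
      have h5 := mul_le_mul_of_nonneg_left hheight (by linarith : 0 ≤ 2 * t)
      linarith

end Potentials

/-! ### Rounds of answering and evicting -/

/-- A nonnegative function with a supporting line of slope `-s` at `x` is bounded below by a hinge
`s * max 0 (b - ·)` that is compatible with its value at `x`. -/
theorem exists_hinge {g : ℝ → ℝ} {s x : ℝ} (hs : 0 ≤ s) (hx0 : 0 ≤ x) (hx1 : x ≤ 1)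
    (hg0 : ∀ y ∈ Set.Icc (0 : ℝ) 1, 0 ≤ g y)
    (hg : ∀ y ∈ Set.Icc (0 : ℝ) 1, g x + s * (x - y) ≤ g y) :
    ∃ b ∈ Set.Icc (0 : ℝ) 1, ∀ y ∈ Set.Icc (0 : ℝ) 1, s * max 0 (b - y) ≤ g y ∧
      g x - g y ≤ s * (b - x) - s * max 0 (b - y) := by
  have hgx : 0 ≤ g x := hg0 x ⟨hx0, hx1⟩
  rcases hs.eq_or_lt with rfl | hs
  · refine ⟨0, ⟨le_rfl, zero_le_one⟩, fun y hy => ?_⟩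
    have h1 := hg0 y hy
    have h2 := hg y hy
    constructor <;> linarith
  · have hq : s * (x + g x / s) = s * x + g x := by field_simp
    have hq0 : 0 ≤ g x / s := by positivity
    -- the zero of the supporting line, cut off at `1`
    refine ⟨min 1 (x + g x / s), ⟨le_min zero_le_one (by linarith), min_le_left _ _⟩,
      fun y hy => ?_⟩
    have h1 := hg0 y hy
    have h2 := hg y hy
    rcases le_total 1 (x + g x / s) with h | h
    · rw [min_eq_left h, max_eq_right (by linarith [hy.2])]
      constructor <;> nlinarith
    · rw [min_eq_right h]
      rcases max_choice 0 (x + g x / s - y) with h' | h' <;> rw [h'] <;>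
        constructor <;> nlinarith

section Round

variable {M : Type*} [Fintype M] {ω : M → ℝ} {δ : ℝ} {u : M → ℝ → ℝ}

/-- One round: the profiles are lowered in response to the hinges that support the cost functions
`g` at the current allocation, with step length `h`, and then raised again. The service potential
pays for the service cost at the allocation before the round, up to a term of second order. -/
theorem exists_round [Nonempty M] (hω : ∀ i, 0 < ω i) (hδ : 0 < δ)
    (hδn : δ * Fintype.card M ≤ 1) (hu : ∀ i, IsProfile (u i))
    (hm : ∑ i, mass (u i) = Fintype.card M - 1) {g : M → ℝ → ℝ} {B h e : ℝ} (hh : 0 ≤ h)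
    (he : 0 < e) (hg0 : ∀ i, ∀ y ∈ Set.Icc (0 : ℝ) 1, 0 ≤ g i y)
    (hg : ∀ i, ∀ x ∈ Set.Icc (0 : ℝ) 1, ∃ s, 0 ≤ s ∧ s ≤ B ∧
      ∀ y ∈ Set.Icc (0 : ℝ) 1, g i x + s * (x - y) ≤ g i y) :
    ∃ v : M → ℝ → ℝ, (∀ i, IsProfile (v i)) ∧ ∑ i, mass (v i) = Fintype.card M - 1 ∧
      ∀ y ∈ stdSimplex ℝ M,
        h * ∑ i, g i (1 - mass (u i)) + servicePot δ ω y v ≤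
          servicePot δ ω y u + h * ∑ i, g i (y i) +
            (h ^ 2 * ∑ i, (1 + δ) * B ^ 2 / ω i + e) ∧
        ∑ i, ω i * |mass (v i) - mass (u i)| + movePot δ ω y v ≤
          movePot δ ω y u + 4 * (h * ∑ i, g i (y i)) + 2 * e := by
  have hx : ∀ i, 1 - mass (u i) ∈ Set.Icc (0 : ℝ) 1 := fun i =>
    ⟨by linarith [(hu i).mass_le_one], by linarith [(hu i).mass_nonneg]⟩
  choose s hs0 hsB hs using fun i => hg i _ (hx i)
  choose b hb hby using fun i => exists_hinge (hs0 i) (hx i).1 (hx i).2 (hg0 i) (hs i)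
  have hr : ∀ i, 0 ≤ h * s i / ω i := fun i => div_nonneg (mul_nonneg hh (hs0 i)) (hω i).le
  have hωr : ∀ i, ω i * (h * s i / ω i) = h * s i := fun i => by
    have := (hω i).ne'
    field_simp
  set w : M → ℝ → ℝ := fun i => lower δ (h * s i / ω i) (b i) (u i) with hw
  have hwp : ∀ i, IsProfile (w i) := fun i => (hu i).lower_isProfile hδ (hr i)
  have hwu : ∀ i, mass (w i) ≤ mass (u i) := fun i =>
    (hwp i).mass_mono (hu i) ((hu i).lower_le hδ (hr i))
  obtain ⟨v, hv, hwv, hvm, hvy⟩ := exists_raise (ω := ω) hω hδ hδn hwp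
    ((Finset.sum_le_sum fun i _ => hwu i).trans hm.le) he
  refine ⟨v, hv, hvm, fun y hy => ?_⟩
  have hy1 : ∀ i, y i ∈ Set.Icc (0 : ℝ) 1 := fun i => mem_Icc_of_mem_stdSimplex hy i
  obtain ⟨h1, h2⟩ := hvy y hy
  constructor
  · have key : servicePot δ ω y w - servicePot δ ω y u ≤
        ∑ i, (h * (g i (y i) - g i (1 - mass (u i))) + h ^ 2 * ((1 + δ) * B ^ 2 / ω i)) := by
      rw [servicePot, servicePot, ← Finset.sum_sub_distrib]
      refine Finset.sum_le_sum fun i _ => ?_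
      rw [← mul_sub]
      refine ((hu i).energy_sub_logTail_lower hδ (hω i) (hr i) (hb i).1 (hb i).2 (hy1 i).1
        (hy1 i).2).trans ?_
      rw [hωr]
      have h3 := mul_le_mul_of_nonneg_left (hby i (y i) (hy1 i)).2 hh
      have h4 : h * s i * ((1 + δ) * (h * s i / ω i)) ≤ h ^ 2 * ((1 + δ) * B ^ 2 / ω i) := by
        rw [show h * s i * ((1 + δ) * (h * s i / ω i)) = h ^ 2 * ((1 + δ) * s i ^ 2 / ω i) by ring]
        refine mul_le_mul_of_nonneg_left ?_ (sq_nonneg h)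
        refine div_le_div_of_nonneg_right ?_ (hω i).le
        exact mul_le_mul_of_nonneg_left (pow_le_pow_left₀ (hs0 i) (hsB i) 2) (by linarith)
      linarith
    rw [Finset.sum_add_distrib, ← Finset.mul_sum, ← Finset.mul_sum, Finset.sum_sub_distrib] at key
    linarith
  · have h3 : ∑ i, ω i * |mass (v i) - mass (u i)| ≤
        ∑ i, ω i * (mass (v i) - mass (w i)) + ∑ i, ω i * (mass (u i) - mass (w i)) := by
      rw [← Finset.sum_add_distrib]
      refine Finset.sum_le_sum fun i _ => ?_
      rw [← mul_add]
      refine mul_le_mul_of_nonneg_left ?_ (hω i).le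
      rw [abs_le]
      constructor <;> linarith [hwu i, hwv i]
    have h4 : ∑ i, -(h * g i (y i)) ≤ tailPot δ ω y w - tailPot δ ω y u := by
      rw [tailPot, tailPot, ← Finset.sum_sub_distrib]
      refine Finset.sum_le_sum fun i _ => ?_
      rw [← mul_sub]
      refine le_trans ?_ ((hu i).le_logTail_lower_sub hδ (hω i) (hr i) (hb i).2 (hy1 i).1
        (hy1 i).2)
      rw [hωr, mul_assoc]
      exact neg_le_neg (mul_le_mul_of_nonneg_left (hby i (y i) (hy1 i)).1 hh)
    rw [Finset.sum_neg_distrib, ← Finset.mul_sum] at h4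
    simp only [movePot, mul_sub, Finset.sum_sub_distrib] at h2 h3 ⊢
    linarith

/-- The weighted `ℓ¹` distance. -/
def wdist (ω x y : M → ℝ) : ℝ := ∑ i, ω i * |y i - x i|

theorem wdist_self (ω x : M → ℝ) : wdist ω x x = 0 := by simp [wdist]

theorem wdist_triangle (hω : ∀ i, 0 < ω i) (x y z : M → ℝ) :
    wdist ω x z ≤ wdist ω x y + wdist ω y z := by
  rw [wdist, wdist, wdist, ← Finset.sum_add_distrib]
  refine Finset.sum_le_sum fun i _ => ?_
  rw [← mul_add]
  refine mul_le_mul_of_nonneg_left ?_ (hω i).le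
  rw [add_comm]
  exact abs_sub_le _ _ _

/-- The allocation of the resource that is described by the profiles `u`. -/
noncomputable def alloc (u : M → ℝ → ℝ) : M → ℝ := fun i => 1 - mass (u i)

theorem wdist_alloc (ω : M → ℝ) (u v : M → ℝ → ℝ) :
    wdist ω (alloc u) (alloc v) = ∑ i, ω i * |mass (v i) - mass (u i)| := by
  refine Finset.sum_congr rfl fun i _ => ?_
  rw [alloc, alloc, ← abs_neg]
  congr 2
  ring

/-- Several rounds for the same cost functions, together with an allocation `q` on the way at
which the service cost is at most the average over the rounds. -/
theorem exists_rounds [Nonempty M] (hω : ∀ i, 0 < ω i) (hδ : 0 < δ)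
    (hδn : δ * Fintype.card M ≤ 1) (hu : ∀ i, IsProfile (u i))
    (hm : ∑ i, mass (u i) = Fintype.card M - 1) {g : M → ℝ → ℝ} {B h e : ℝ} (hh : 0 ≤ h)
    (he : 0 < e) (hg0 : ∀ i, ∀ y ∈ Set.Icc (0 : ℝ) 1, 0 ≤ g i y)
    (hg : ∀ i, ∀ x ∈ Set.Icc (0 : ℝ) 1, ∃ s, 0 ≤ s ∧ s ≤ B ∧
      ∀ y ∈ Set.Icc (0 : ℝ) 1, g i x + s * (x - y) ≤ g i y) (N : ℕ) :
    ∃ q v : M → ℝ → ℝ, ((∀ i, IsProfile (q i)) ∧ ∑ i, mass (q i) = Fintype.card M - 1) ∧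
      ((∀ i, IsProfile (v i)) ∧ ∑ i, mass (v i) = Fintype.card M - 1) ∧
      ∀ y ∈ stdSimplex ℝ M,
        N * (h * ∑ i, g i (alloc q i)) + servicePot δ ω y v ≤
          servicePot δ ω y u + N * (h * ∑ i, g i (y i)) +
            N * (h ^ 2 * ∑ i, (1 + δ) * B ^ 2 / ω i + e) ∧
        wdist ω (alloc u) (alloc q) + wdist ω (alloc q) (alloc v) + movePot δ ω y v ≤
          movePot δ ω y u + N * (4 * (h * ∑ i, g i (y i)) + 2 * e) := by
  induction N with
  | zero =>
    exact ⟨u, u, ⟨hu, hm⟩, ⟨hu, hm⟩, fun y _ => by simp [wdist_self]⟩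
  | succ N ih =>
    obtain ⟨q, v, hq, hv, hy⟩ := ih
    obtain ⟨w, hw, hwm, hwy⟩ := exists_round hω hδ hδn hv.1 hv.2 hh he hg0 hg
    have hvw := wdist_alloc ω v w
    rcases le_total (∑ i, g i (alloc q i)) (∑ i, g i (alloc v i)) with hle | hle
    · refine ⟨q, w, hq, ⟨hw, hwm⟩, fun y hyM => ?_⟩
      obtain ⟨h1, h2⟩ := hy y hyM
      obtain ⟨h3, h4⟩ := hwy y hyM
      have h5 := mul_le_mul_of_nonneg_left hle hh
      have h6 := wdist_triangle hω (alloc q) (alloc v) (alloc w)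
      simp only [alloc] at h1 h2 h3 h4 h5 h6 hvw ⊢
      push_cast
      constructor <;> linarith
    · refine ⟨v, w, hv, ⟨hw, hwm⟩, fun y hyM => ?_⟩
      obtain ⟨h1, h2⟩ := hy y hyM
      obtain ⟨h3, h4⟩ := hwy y hyM
      have h5 := mul_le_mul_of_nonneg_left (mul_le_mul_of_nonneg_left hle hh) N.cast_nonneg
      have h6 := wdist_triangle hω (alloc u) (alloc q) (alloc v)
      simp only [alloc] at h1 h2 h3 h4 h5 h6 hvw ⊢
      push_cast
      constructor <;> linarith

end Round

/-! ### Time steps -/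

/-- A supporting line of a cost function at an interior point or at `1`. -/
theorem CostFunction.exists_subgradient (c : CostFunction) {x : ℝ} (hx0 : 0 < x) (hx1 : x ≤ 1) :
    ∃ s, 0 ≤ s ∧ ∀ y ∈ Set.Icc (0 : ℝ) 1,
      Set.IccExtend zero_le_one c.toFun x + s * (x - y) ≤
        Set.IccExtend zero_le_one c.toFun y := by
  set f := Set.IccExtend zero_le_one c.toFun with hf
  have hanti : ∀ y z, y ≤ z → f z ≤ f y := fun y z hyz =>
    c.antitone (Set.monotone_projIcc zero_le_one hyz)
  set S : Set ℝ := (fun z => (f x - f z) / (x - z)) '' Set.Ico 0 x with hS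
  have hne : S.Nonempty := ⟨_, 0, ⟨le_rfl, hx0⟩, rfl⟩
  have hle0 : ∀ a ∈ S, a ≤ 0 := by
    rintro _ ⟨z, hz, rfl⟩
    exact div_nonpos_of_nonpos_of_nonneg (by linarith [hanti z x hz.2.le]) (by linarith [hz.2])
  have hbdd : BddAbove S := ⟨0, hle0⟩
  refine ⟨-sSup S, by linarith [csSup_le hne hle0], fun y hy => ?_⟩
  rcases lt_trichotomy y x with hyx | rfl | hxy
  · have h1 : (f x - f y) / (x - y) ≤ sSup S := le_csSup hbdd ⟨y, ⟨hy.1, hyx⟩, rfl⟩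
    rw [div_le_iff₀ (by linarith)] at h1
    linarith
  · simp
  · have h1 : sSup S ≤ (f y - f x) / (y - x) := by
      refine csSup_le hne ?_
      rintro _ ⟨z, hz, rfl⟩
      exact c.convex.slope_mono_adjacent ⟨hz.1, hz.2.le.trans hx1⟩ hy hz.2 hxy
    rw [le_div_iff₀ (by linarith)] at h1
    linarith

section Step

variable {M : Type*} [Fintype M] {ω : M → ℝ} {δ : ℝ} {u : M → ℝ → ℝ}

theorem alloc_mem_stdSimplex (hu : ∀ i, IsProfile (u i))
    (hm : ∑ i, mass (u i) = Fintype.card M - 1) : alloc u ∈ stdSimplex ℝ M := by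
  refine ⟨fun i => by simpa [alloc] using (hu i).mass_le_one, ?_⟩
  simp only [alloc, Finset.sum_sub_distrib, hm]
  simp

/-- One time step with the tasks `c`: the new allocation `p`, and the new profiles `v`. The
allocation `p` need not be the one that `v` describes; the detour from `alloc u` over `p` to
`alloc v` is paid. -/
theorem exists_step [Nonempty M] (hω : ∀ i, 0 < ω i) (hδ : 0 < δ)
    (hδn : δ * Fintype.card M ≤ 1) (hu : ∀ i, IsProfile (u i))
    (hm : ∑ i, mass (u i) = Fintype.card M - 1) (c : TaskVector M) {e : ℝ} (he : 0 < e) :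
    ∃ (p : Allocation M) (v : M → ℝ → ℝ), (∀ i, IsProfile (v i)) ∧
      ∑ i, mass (v i) = Fintype.card M - 1 ∧
      ∀ y : Allocation M,
        stepServiceCost c p + servicePot δ ω y.1 v ≤
          servicePot δ ω y.1 u + stepServiceCost c y + e ∧
        wdist ω (alloc u) p.1 + wdist ω p.1 (alloc v) + movePot δ ω y.1 v ≤
          movePot δ ω y.1 u + 4 * stepServiceCost c y + e := by
  set n : ℝ := (Fintype.card M : ℝ) with hn
  have hn1 : 1 ≤ n := by
    rw [hn]
    exact_mod_cast Fintype.card_pos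
  have hn0 : 0 < n := by linarith
  set f : M → ℝ → ℝ := fun i => Set.IccExtend zero_le_one (c i).toFun with hf
  have hf0 : ∀ i z, 0 ≤ f i z := fun i z => (c i).nonneg _
  have hcost : ∀ y : Allocation M, stepServiceCost c y = ∑ i, f i (y.1 i) := fun y =>
    Finset.sum_congr rfl fun i _ => by
      rw [hf]
      exact (Set.IccExtend_of_mem _ _ _).symm
  set F := ∑ i, f i 0 with hF
  have hF0 : 0 ≤ F := Finset.sum_nonneg fun i _ => hf0 i 0
  set Ω := ∑ i, ω i with hΩ
  have hΩ0 : 0 < Ω := Finset.sum_pos (fun i _ => hω i) Finset.univ_nonempty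
  -- the weight of the uniform allocation that is mixed in to keep the slopes bounded
  set κ := min (1 / 2) (e / (16 * (F + Ω))) with hκ
  have hκ0 : 0 < κ := by positivity
  have hκ1 : κ ≤ 1 / 2 := min_le_left _ _
  have hκe : κ * (F + Ω) ≤ e / 16 := by
    have := mul_le_mul_of_nonneg_right (min_le_right (1 / 2) (e / (16 * (F + Ω))))
      (by positivity : 0 ≤ F + Ω)
    refine this.trans (le_of_eq ?_)
    field_simp
  have hκF : κ * F ≤ e / 16 := by nlinarith
  have hκΩ : κ * Ω ≤ e / 16 := by nlinarith
  set mix : ℝ → ℝ := fun z => (1 - κ) * z + κ * (1 / n) with hmix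
  have hinv0 : 0 < 1 / n := by positivity
  have hinv1 : 1 / n ≤ 1 := (div_le_one hn0).2 hn1
  have hmix0 : ∀ z, 0 ≤ z → κ * (1 / n) ≤ mix z := fun z hz => by
    simp only [hmix]
    nlinarith
  have hmix1 : ∀ z, z ≤ 1 → mix z ≤ 1 := fun z hz => by
    simp only [hmix]
    nlinarith
  set g : M → ℝ → ℝ := fun i z => f i (mix z) with hg
  have hg0 : ∀ i, ∀ y ∈ Set.Icc (0 : ℝ) 1, 0 ≤ g i y := fun i y _ => hf0 i _
  have hgsub : ∀ i, ∀ x ∈ Set.Icc (0 : ℝ) 1, ∃ s, 0 ≤ s ∧ s ≤ F / (κ * (1 / n)) ∧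
      ∀ y ∈ Set.Icc (0 : ℝ) 1, g i x + s * (x - y) ≤ g i y := fun i x hx => by
    have hx0 := hmix0 x hx.1
    have hpos : 0 < κ * (1 / n) := by positivity
    obtain ⟨s, hs0, hs⟩ := (c i).exists_subgradient (hpos.trans_le hx0) (hmix1 x hx.2)
    refine ⟨(1 - κ) * s, mul_nonneg (by linarith) hs0, ?_, fun y hy => ?_⟩
    · rw [le_div_iff₀ hpos]
      have h1 : f i (mix x) + s * (mix x - 0) ≤ f i 0 := hs 0 ⟨le_rfl, zero_le_one⟩
      have h2 : f i 0 ≤ F := Finset.single_le_sum (f := fun i => f i 0)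
        (fun j _ => hf0 j 0) (Finset.mem_univ i)
      have h3 := hf0 i (mix x)
      have h4 := mul_le_mul_of_nonneg_left hx0 hs0
      have h5 : 0 ≤ s * (κ * (1 / n)) := by positivity
      nlinarith
    · have h1 := hs (mix y) ⟨by linarith [hmix0 y hy.1], hmix1 y hy.2⟩
      have h2 : mix x - mix y = (1 - κ) * (x - y) := by
        simp only [hmix]
        ring
      rw [h2] at h1
      calc g i x + (1 - κ) * s * (x - y) = g i x + s * ((1 - κ) * (x - y)) := by ring
        _ ≤ g i y := h1
  -- the cost functions `g` exceed the costs `f` only slightly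
  have hgy : ∀ y : Allocation M, ∑ i, g i (y.1 i) ≤ stepServiceCost c y + e / 16 := fun y => by
    have h1 : ∑ i, g i (y.1 i) ≤ ∑ i, (f i (y.1 i) + κ * f i 0) := by
      refine Finset.sum_le_sum fun i _ => ?_
      have h2 := (c i).convex.2 (mem_Icc_of_mem_stdSimplex y.2 i)
        (⟨hinv0.le, hinv1⟩ : 1 / n ∈ Set.Icc (0 : ℝ) 1)
        (by linarith : 0 ≤ 1 - κ) hκ0.le (by ring)
      simp only [smul_eq_mul] at h2
      have h3 : f i (1 / n) ≤ f i 0 :=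
        (c i).antitone (Set.monotone_projIcc zero_le_one hinv0.le)
      have h4 : g i (y.1 i) ≤ (1 - κ) * f i (y.1 i) + κ * f i (1 / n) := h2
      have h5 := mul_le_mul_of_nonneg_left h3 hκ0.le
      have h6 := mul_nonneg hκ0.le (hf0 i (y.1 i))
      linarith
    rw [Finset.sum_add_distrib, ← Finset.mul_sum, ← hF, ← hcost] at h1
    linarith
  set B := F / (κ * (1 / n)) with hB
  set Q := ∑ i, (1 + δ) * B ^ 2 / ω i with hQ
  have hQ0 : 0 ≤ Q := Finset.sum_nonneg fun i _ => by
    have := hω i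
    positivity
  -- with `N` rounds of step length `1 / N` the terms of second order add up to `Q / N`
  obtain ⟨N, hN⟩ := exists_nat_ge (1 + 8 * Q / e)
  have hN0 : (0 : ℝ) < N := lt_of_lt_of_le (by positivity) hN
  have hQN : Q / N ≤ e / 8 := by
    rw [div_le_iff₀ hN0]
    have : 8 * Q / e ≤ N := by linarith
    rw [div_le_iff₀ he] at this
    linarith
  obtain ⟨q, v, hq, hv, hyv⟩ := exists_rounds hω hδ hδn hu hm (h := 1 / N) (e := e / (8 * N))
    (by positivity) (by positivity) hg0 hgsub N
  have hqS := alloc_mem_stdSimplex hq.1 hq.2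
  have hpS : (fun i => mix (alloc q i)) ∈ stdSimplex ℝ M := by
    refine ⟨fun i => le_trans (by positivity) (hmix0 _ (hqS.1 i)), ?_⟩
    simp only [hmix, Finset.sum_add_distrib, ← Finset.mul_sum, hqS.2, Finset.sum_const,
      Finset.card_univ, nsmul_eq_mul, ← hn]
    field_simp
    ring
  have hpq : ∀ i, |mix (alloc q i) - alloc q i| ≤ κ := fun i => by
    have h1 := mem_Icc_of_mem_stdSimplex hqS i
    rw [show mix (alloc q i) - alloc q i = κ * (1 / n - alloc q i) by simp only [hmix]; ring,
      abs_mul, abs_of_pos hκ0]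
    have : |1 / n - alloc q i| ≤ 1 := by
      rw [abs_le]
      constructor <;> linarith [h1.1, h1.2]
    nlinarith
  have hd1 : wdist ω (alloc q) (fun i => mix (alloc q i)) ≤ e / 16 := by
    refine le_trans ?_ hκΩ
    rw [wdist, mul_comm, hΩ, Finset.sum_mul]
    exact Finset.sum_le_sum fun i _ => mul_le_mul_of_nonneg_left (hpq i) (hω i).le
  have hd2 : wdist ω (fun i => mix (alloc q i)) (alloc q) ≤ e / 16 := by
    refine le_trans (le_of_eq ?_) hd1
    exact Finset.sum_congr rfl fun i _ => by rw [abs_sub_comm]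
  refine ⟨⟨_, hpS⟩, v, hv.1, hv.2, fun y => ?_⟩
  obtain ⟨h1, h2⟩ := hyv y.1 y.2
  have hc := hgy y
  constructor
  · rw [hcost]
    rw [show (N : ℝ) * (1 / N * ∑ i, g i (alloc q i)) = ∑ i, g i (alloc q i) by field_simp,
      show (N : ℝ) * (1 / N * ∑ i, g i (y.1 i)) = ∑ i, g i (y.1 i) by field_simp,
      show (N : ℝ) * ((1 / N) ^ 2 * Q + e / (8 * N)) = Q / N + e / 8 by field_simp] at h1
    have h3 : ∑ i, f i (mix (alloc q i)) = ∑ i, g i (alloc q i) := rfl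
    dsimp only
    linarith
  · rw [show (N : ℝ) * (4 * (1 / N * ∑ i, g i (y.1 i)) + 2 * (e / (8 * N))) =
      4 * ∑ i, g i (y.1 i) + e / 4 by field_simp; ring] at h2
    have h3 := wdist_triangle hω (alloc u) (alloc q) (fun i => mix (alloc q i))
    have h4 := wdist_triangle hω (fun i => mix (alloc q i)) (alloc q) (alloc v)
    dsimp only
    linarith

end Step

/-! ### The transport norm of a star -/

section Star

variable {M : Type*} [Fintype M] [MetricSpace M] {w : M → ℝ}

theorem sum_weight_abs_le_flow_cost (hw : ∀ i, 0 < w i)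
    (hd : ∀ i j, i ≠ j → dist i j = w i + w j) {z : M → ℝ} {f : M → M → ℝ}
    (hf : ∀ i j, 0 ≤ f i j) (hz : ∀ i, z i = ∑ j, (f j i - f i j)) :
    ∑ i, w i * |z i| ≤ ∑ i, ∑ j, f i j * dist i j := by
  classical
  have h1 : ∀ i, w i * |z i| ≤
      ∑ j, ((if i = j then 0 else f j i * w i) + if i = j then 0 else f i j * w i) := fun i => by
    rw [hz i, mul_comm]
    refine (mul_le_mul_of_nonneg_right (Finset.abs_sum_le_sum_abs _ _) (hw i).le).trans ?_
    rw [Finset.sum_mul]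
    refine Finset.sum_le_sum fun j _ => ?_
    split_ifs with h
    · simp [h]
    · rw [← add_mul]
      refine mul_le_mul_of_nonneg_right ?_ (hw i).le
      rw [abs_le]
      constructor <;> linarith [hf i j, hf j i]
  refine (Finset.sum_le_sum fun i _ => h1 i).trans (le_of_eq ?_)
  simp only [Finset.sum_add_distrib]
  rw [Finset.sum_comm, ← Finset.sum_add_distrib]
  refine Finset.sum_congr rfl fun i _ => ?_
  rw [← Finset.sum_add_distrib]
  refine Finset.sum_congr rfl fun j _ => ?_
  rcases eq_or_ne i j with rfl | h
  · simp
  · rw [if_neg h.symm, if_neg h, hd i j h]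
    ring

/-- The flow from `i` to `j` that is proportional to the product of the negative part of `z i` and
the positive part of `z j` is optimal on a star. If `z = 0`, then the division by `S = 0` gives the
flow `0`, as it should. -/
theorem exists_flow_cost_le (hw : ∀ i, 0 < w i)
    (hd : ∀ i j, i ≠ j → dist i j = w i + w j) {z : M → ℝ} (hz : ∑ i, z i = 0) :
    ∃ f : M → M → ℝ, (∀ i j, 0 ≤ f i j) ∧ (∀ i, z i = ∑ j, (f j i - f i j)) ∧
      ∑ i, ∑ j, f i j * dist i j ≤ ∑ i, w i * |z i| := by
  set S := ∑ i, max (z i) 0 with hS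
  have hpm : ∀ i, max (z i) 0 - max (-z i) 0 = z i := fun i => max_zero_sub_eq_self (z i)
  have hS' : ∑ i, max (-z i) 0 = S := by
    have : ∑ i, (max (z i) 0 - max (-z i) 0) = 0 := by simp_rw [hpm, hz]
    rw [Finset.sum_sub_distrib] at this
    linarith
  have hS0 : 0 ≤ S := Finset.sum_nonneg fun i _ => le_max_right _ _
  have hzero : ∀ i, S = 0 → max (z i) 0 = 0 ∧ max (-z i) 0 = 0 := fun i h => by
    constructor
    · exact (Finset.sum_eq_zero_iff_of_nonneg fun i _ => le_max_right _ _).1 (hS.symm.trans h) i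
        (Finset.mem_univ i)
    · exact (Finset.sum_eq_zero_iff_of_nonneg fun i _ => le_max_right _ _).1 (hS'.trans h) i
        (Finset.mem_univ i)
  have hdiv : ∀ i, max (z i) 0 * S / S = max (z i) 0 ∧ max (-z i) 0 * S / S = max (-z i) 0 :=
    fun i => by
      rcases eq_or_ne S 0 with h | h
      · simp [hzero i h]
      · constructor <;> field_simp
  refine ⟨fun i j => max (-z i) 0 * max (z j) 0 / S, fun i j => by positivity, fun i => ?_, ?_⟩
  · rw [Finset.sum_sub_distrib, ← Finset.sum_div, ← Finset.sum_div, ← Finset.sum_mul,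
      ← Finset.mul_sum, hS', ← hS, mul_comm S, (hdiv i).1, (hdiv i).2, hpm]
  · have hle : ∀ i j, max (-z i) 0 * max (z j) 0 / S * dist i j ≤
        w i * max (-z i) 0 * max (z j) 0 / S + max (-z i) 0 * (w j * max (z j) 0) / S :=
      fun i j => by
        have h1 : dist i j ≤ w i + w j := by
          rcases eq_or_ne i j with rfl | h
          · rw [dist_self]
            linarith [hw i]
          · exact (hd i j h).le
        refine (mul_le_mul_of_nonneg_left h1 (by positivity)).trans (le_of_eq ?_)
        ring
    refine (Finset.sum_le_sum fun i _ => Finset.sum_le_sum fun j _ => hle i j).trans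
      (le_of_eq ?_)
    have habs : ∀ i, |z i| = max (-z i) 0 + max (z i) 0 := fun i => by
      rw [add_comm, max_zero_add_max_neg_zero_eq_abs_self]
    simp only [Finset.sum_add_distrib, ← Finset.sum_div, ← Finset.mul_sum, ← Finset.sum_mul,
      hS', ← hS, habs, mul_add]
    rcases eq_or_ne S 0 with h | h
    · simp [hzero _ h]
    · field_simp

theorem transportNorm_eq (hw : ∀ i, 0 < w i)
    (hd : ∀ i j, i ≠ j → dist i j = w i + w j) {z : M → ℝ} (hz : ∑ i, z i = 0) :
    transportNorm z = ∑ i, w i * |z i| := by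
  have hlb : ∀ κ ∈ {κ : ℝ | ∃ f : M → M → ℝ, (∀ i j, 0 ≤ f i j) ∧
      (∀ i, z i = ∑ j, (f j i - f i j)) ∧ κ = ∑ i, ∑ j, f i j * dist i j},
      ∑ i, w i * |z i| ≤ κ := by
    rintro _ ⟨f, hf, hfz, rfl⟩
    exact sum_weight_abs_le_flow_cost hw hd hf hfz
  obtain ⟨f, hf, hfz, hfle⟩ := exists_flow_cost_le hw hd hz
  exact le_antisymm ((csInf_le ⟨_, hlb⟩ ⟨f, hf, hfz, rfl⟩).trans hfle)
    (le_csInf ⟨_, f, hf, hfz, rfl⟩ hlb)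

theorem stepMovementCost_eq (hw : ∀ i, 0 < w i)
    (hd : ∀ i j, i ≠ j → dist i j = w i + w j) (x y : Allocation M) :
    stepMovementCost x y = wdist w x.1 y.1 :=
  transportNorm_eq hw hd (by rw [Finset.sum_sub_distrib, x.2.2, y.2.2, sub_self])

end Star

/-! ### Bounds on the potentials -/

section Bounds

variable {M : Type*} [Fintype M] {ω : M → ℝ} {δ Λ : ℝ} {u : M → ℝ → ℝ}

theorem abs_tailPot_sub_le (hω : ∀ i, 0 < ω i) (hδ : 0 < δ) (h1 : -Λ ≤ Real.log δ)
    (h2 : Real.log (1 + δ) ≤ Λ) (hu : ∀ i, IsProfile (u i)) (y y' : M → ℝ) :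
    |tailPot δ ω y' u - tailPot δ ω y u| ≤ Λ * wdist ω y y' := by
  rw [tailPot, tailPot, ← Finset.sum_sub_distrib, wdist, Finset.mul_sum]
  refine (Finset.abs_sum_le_sum_abs _ _).trans (Finset.sum_le_sum fun i _ => ?_)
  rw [← mul_sub, abs_mul, abs_of_pos (hω i)]
  have := mul_le_mul_of_nonneg_left ((hu i).abs_logTail_sub_le hδ h1 h2 (y i) (y' i)) (hω i).le
  linarith

theorem abs_tailPot_le (hω : ∀ i, 0 < ω i) (hδ : 0 < δ) (h1 : -Λ ≤ Real.log δ)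
    (h2 : Real.log (1 + δ) ≤ Λ) (hu : ∀ i, IsProfile (u i)) {y : M → ℝ}
    (hy : y ∈ stdSimplex ℝ M) : |tailPot δ ω y u| ≤ Λ * ∑ i, ω i := by
  rw [tailPot, Finset.mul_sum]
  refine (Finset.abs_sum_le_sum_abs _ _).trans (Finset.sum_le_sum fun i _ => ?_)
  rw [abs_mul, abs_of_pos (hω i), mul_comm]
  have hy1 := mem_Icc_of_mem_stdSimplex hy i
  exact mul_le_mul_of_nonneg_right ((hu i).abs_logTail_le hδ h1 h2 hy1.1 hy1.2) (hω i).le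

theorem servicePot_eq (δ : ℝ) (ω y : M → ℝ) (u : M → ℝ → ℝ) :
    servicePot δ ω y u = ∑ i, ω i * energy δ (u i) - tailPot δ ω y u := by
  simp only [servicePot, tailPot, mul_sub, Finset.sum_sub_distrib]

theorem abs_servicePot_le (hω : ∀ i, 0 < ω i) (hδ : 0 < δ) (h1 : -Λ ≤ Real.log δ)
    (h2 : Real.log (1 + δ) ≤ Λ) (hu : ∀ i, IsProfile (u i)) {y : M → ℝ}
    (hy : y ∈ stdSimplex ℝ M) : |servicePot δ ω y u| ≤ (1 + δ * Λ + Λ) * ∑ i, ω i := by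
  have h3 : |∑ i, ω i * energy δ (u i)| ≤ (1 + δ * Λ) * ∑ i, ω i := by
    rw [Finset.mul_sum]
    refine (Finset.abs_sum_le_sum_abs _ _).trans (Finset.sum_le_sum fun i _ => ?_)
    rw [abs_mul, abs_of_pos (hω i), mul_comm]
    exact mul_le_mul_of_nonneg_right ((hu i).abs_energy_le hδ h1 h2) (hω i).le
  have h4 := abs_tailPot_le hω hδ h1 h2 hu hy
  rw [servicePot_eq]
  refine (abs_sub _ _).trans ?_
  linarith

theorem abs_movePot_le (hω : ∀ i, 0 < ω i) (hδ : 0 < δ) (h1 : -Λ ≤ Real.log δ)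
    (h2 : Real.log (1 + δ) ≤ Λ) (hu : ∀ i, IsProfile (u i)) {y : M → ℝ}
    (hy : y ∈ stdSimplex ℝ M) : |movePot δ ω y u| ≤ (1 + 4 * Λ) * ∑ i, ω i := by
  have h3 : |∑ i, ω i * mass (u i)| ≤ 1 * ∑ i, ω i := by
    rw [Finset.mul_sum]
    refine (Finset.abs_sum_le_sum_abs _ _).trans (Finset.sum_le_sum fun i _ => ?_)
    rw [abs_mul, abs_of_pos (hω i), mul_comm, abs_of_nonneg (hu i).mass_nonneg]
    exact mul_le_mul_of_nonneg_right (hu i).mass_le_one (hω i).le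
  have h4 := abs_tailPot_le hω hδ h1 h2 hu hy
  rw [movePot]
  refine (abs_sub _ _).trans ?_
  rw [abs_mul, abs_of_nonneg (by norm_num : (0 : ℝ) ≤ 4)]
  linarith

theorem wdist_le_sum (hω : ∀ i, 0 < ω i) {x y : M → ℝ} (hx : x ∈ stdSimplex ℝ M)
    (hy : y ∈ stdSimplex ℝ M) : wdist ω x y ≤ ∑ i, ω i := by
  refine Finset.sum_le_sum fun i _ => ?_
  have h1 := mem_Icc_of_mem_stdSimplex hx i
  have h2 := mem_Icc_of_mem_stdSimplex hy i
  have : |y i - x i| ≤ 1 := by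
    rw [abs_le]
    constructor <;> linarith [h1.1, h1.2, h2.1, h2.2]
  nlinarith [hω i]

theorem wdist_nonneg (hω : ∀ i, 0 < ω i) (x y : M → ℝ) : 0 ≤ wdist ω x y :=
  Finset.sum_nonneg fun i _ => mul_nonneg (hω i).le (abs_nonneg _)

end Bounds

/-! ### The online algorithm -/

theorem stepServiceCost_nonneg {M : Type*} [Fintype M] (c : TaskVector M) (x : Allocation M) :
    0 ≤ stepServiceCost c x :=
  Finset.sum_nonneg fun i _ => (c i).nonneg _

theorem serviceCost_nonneg {M : Type*} [Fintype M] (c : ℕ → TaskVector M)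
    (x : ℕ → Allocation M) (T : ℕ) : 0 ≤ serviceCost c x T :=
  Finset.sum_nonneg fun _ _ => stepServiceCost_nonneg _ _

/-- On a star with at least two points some algorithm has `1`-competitive service cost and
`4 * log n`-competitive movement cost. -/
theorem exists_algorithm {M : Type*} [Fintype M] [Nonempty M] [MetricSpace M] {w : M → ℝ}
    (hw : ∀ i, 0 < w i) (hd : ∀ i j, i ≠ j → dist i j = w i + w j)
    (hcard : 2 ≤ Fintype.card M) :
    ∃ A : OnlineAlgorithm M, HasCompetitiveServiceCost A 1 ∧
      HasCompetitiveMovementCost A (4 * Real.log (Fintype.card M)) := by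
  set n : ℝ := (Fintype.card M : ℝ) with hn
  have hn2 : 2 ≤ n := by
    rw [hn]
    exact_mod_cast hcard
  have hn0 : 0 < n := by linarith
  set Λ := Real.log n with hΛ
  have hΛ0 : 0 < Λ := Real.log_pos (by linarith)
  -- `δ = 1 / n` keeps the shifts `δ` of all points together below `1`, and the logarithms
  -- of the regularizer in `[-log n, log n]`
  set δ := 1 / n with hδdef
  have hδ : 0 < δ := by positivity
  have hδn : δ * n ≤ 1 := by
    rw [hδdef]
    field_simp
    exact le_rfl
  have h1 : -Λ ≤ Real.log δ := by rw [hδdef, one_div, Real.log_inv]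
  have h2 : Real.log (1 + δ) ≤ Λ := by
    refine Real.log_le_log (by positivity) ?_
    have : δ ≤ 1 := (div_le_one hn0).2 (by linarith)
    linarith
  -- with these weights an offline movement changes the tail potential by at most its cost
  set ω : M → ℝ := fun i => w i / Λ with hωdef
  have hω : ∀ i, 0 < ω i := fun i => div_pos (hw i) hΛ0
  have hwω : ∀ x y : M → ℝ, wdist w x y = Λ * wdist ω x y := fun x y => by
    rw [wdist, wdist, Finset.mul_sum]
    refine Finset.sum_congr rfl fun i _ => ?_
    simp only [hωdef]
    field_simp
  let State := {u : M → ℝ → ℝ // (∀ i, IsProfile (u i)) ∧ ∑ i, mass (u i) = n - 1}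
  have hstep : ∀ (k : ℕ) (s : State) (c : TaskVector M), ∃ r : Allocation M × State,
      ∀ y : Allocation M,
        stepServiceCost c r.1 + servicePot δ ω y.1 r.2.1 ≤
          servicePot δ ω y.1 s.1 + stepServiceCost c y + (1 / 2) ^ (k + 1) ∧
        wdist ω (alloc s.1) r.1.1 + wdist ω r.1.1 (alloc r.2.1) + movePot δ ω y.1 r.2.1 ≤
          movePot δ ω y.1 s.1 + 4 * stepServiceCost c y + (1 / 2) ^ (k + 1) := by
    intro k s c
    obtain ⟨p, v, hv, hvm, h⟩ := exists_step hω hδ hδn s.2.1 s.2.2 c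
      (e := (1 / 2) ^ (k + 1)) (by positivity)
    exact ⟨(p, ⟨v, hv, hvm⟩), h⟩
  choose step hstep using hstep
  have hinit : (∀ _ : M, IsProfile fun _ => 1 - δ) ∧ ∑ _i : M, mass (fun _ => 1 - δ) = n - 1 := by
    refine ⟨fun _ => IsProfile.const ?_ (by linarith), ?_⟩
    · have : δ ≤ 1 := (div_le_one hn0).2 (by linarith)
      linarith
    · simp only [mass, intervalIntegral.integral_const, Finset.sum_const, Finset.card_univ,
        nsmul_eq_mul, ← hn, sub_zero, one_smul, hδdef]
      field_simp
  let init : State := ⟨fun _ _ => 1 - δ, hinit⟩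
  -- the first component counts the time steps, which sets the error allowed in the next one
  let next : ℕ × Allocation M × State → TaskVector M → ℕ × Allocation M × State :=
    fun q c => (q.1 + 1, step q.1 q.2.2 c)
  let A : OnlineAlgorithm M := ⟨fun x₀ l => (l.foldl next (0, x₀, init)).2.1⟩
  let F : Allocation M → (ℕ → TaskVector M) → ℕ → ℕ × Allocation M × State :=
    fun x₀ c t => ((List.range t).map c).foldl next (0, x₀, init)
  have hF0 : ∀ x₀ c, F x₀ c 0 = (0, x₀, init) := fun x₀ c => rfl
  have hFs : ∀ x₀ c t, F x₀ c (t + 1) = next (F x₀ c t) (c t) := fun x₀ c t => by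
    simp only [F, List.range_succ, List.map_append, List.foldl_append, List.map_cons,
      List.map_nil, List.foldl_cons, List.foldl_nil]
  have hFt : ∀ x₀ c t, (F x₀ c t).1 = t := fun x₀ c t => by
    induction t with
    | zero => rfl
    | succ t ih =>
      rw [hFs]
      exact congrArg (· + 1) ih
  have hrun : ∀ x₀ c t, A.run x₀ c t = (F x₀ c t).2.1 := fun x₀ c t => by
    cases t <;> rfl
  have hone : ∀ x₀ c t (y : Allocation M),
      stepServiceCost (c t) (A.run x₀ c (t + 1)) +
        servicePot δ ω y.1 (F x₀ c (t + 1)).2.2.1 ≤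
          servicePot δ ω y.1 (F x₀ c t).2.2.1 + stepServiceCost (c t) y + (1 / 2) ^ (t + 1) ∧
      wdist ω (alloc (F x₀ c t).2.2.1) (A.run x₀ c (t + 1)).1 +
        wdist ω (A.run x₀ c (t + 1)).1 (alloc (F x₀ c (t + 1)).2.2.1) +
          movePot δ ω y.1 (F x₀ c (t + 1)).2.2.1 ≤
        movePot δ ω y.1 (F x₀ c t).2.2.1 + 4 * stepServiceCost (c t) y + (1 / 2) ^ (t + 1) := by
    intro x₀ c t y
    have h := hstep (F x₀ c t).1 (F x₀ c t).2.2 (c t) y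
    rw [hFt] at h
    rw [hrun, hFs]
    simp only [next, hFt]
    exact h
  have hlip : ∀ (s : State) (y y' : Allocation M),
      |tailPot δ ω y'.1 s.1 - tailPot δ ω y.1 s.1| ≤ stepMovementCost y y' := fun s y y' => by
    rw [stepMovementCost_eq hw hd, hwω]
    exact abs_tailPot_sub_le hω hδ h1 h2 s.2.1 _ _
  refine ⟨A, ⟨2 * ((1 + δ * Λ + Λ) * ∑ i, ω i) + 1, fun x₀ c T y => ?_⟩,
    ⟨Λ * (∑ i, ω i + 2 * ((1 + 4 * Λ) * ∑ i, ω i) + 1), fun x₀ c T y => ?_⟩⟩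
  · have key : ∀ T, serviceCost c (A.run x₀ c) T + servicePot δ ω (y T).1 (F x₀ c T).2.2.1 ≤
        servicePot δ ω (y 0).1 (F x₀ c 0).2.2.1 + (movementCost y T + serviceCost c y T) +
          (1 - (1 / 2) ^ T) := by
      intro T
      induction T with
      | zero => simp [serviceCost, movementCost]
      | succ T ih =>
        have h3 := (hone x₀ c T (y (T + 1))).1
        have h4 := abs_le.1 (hlip (F x₀ c T).2.2 (y T) (y (T + 1)))
        have h5 := servicePot_eq δ ω (y T).1 (F x₀ c T).2.2.1
        have h6 := servicePot_eq δ ω (y (T + 1)).1 (F x₀ c T).2.2.1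
        have h7 : ((1 : ℝ) / 2) ^ T = 2 * (1 / 2) ^ (T + 1) := by ring
        simp only [serviceCost, movementCost, Finset.sum_range_succ] at ih ⊢
        linarith [h4.1, h4.2]
    have h3 := key T
    have h4 := abs_le.1 (abs_servicePot_le hω hδ h1 h2 (F x₀ c T).2.2.2.1 (y T).2)
    have h5 := abs_le.1 (abs_servicePot_le hω hδ h1 h2 (F x₀ c 0).2.2.2.1 (y 0).2)
    have h6 : (0 : ℝ) ≤ (1 / 2) ^ T := by positivity
    linarith [h4.1, h5.2]
  · have key : ∀ T, ∑ t ∈ Finset.range T, wdist ω (A.run x₀ c t).1 (A.run x₀ c (t + 1)).1 +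
        wdist ω (A.run x₀ c T).1 (alloc (F x₀ c T).2.2.1) +
          movePot δ ω (y T).1 (F x₀ c T).2.2.1 ≤
        wdist ω (A.run x₀ c 0).1 (alloc (F x₀ c 0).2.2.1) +
          movePot δ ω (y 0).1 (F x₀ c 0).2.2.1 + 4 * (movementCost y T + serviceCost c y T) +
          (1 - (1 / 2) ^ T) := by
      intro T
      induction T with
      | zero => simp [serviceCost, movementCost]
      | succ T ih =>
        have h3 := (hone x₀ c T (y (T + 1))).2
        have h4 := abs_le.1 (hlip (F x₀ c T).2.2 (y T) (y (T + 1)))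
        have h5 := wdist_triangle hω (A.run x₀ c T).1 (alloc (F x₀ c T).2.2.1)
          (A.run x₀ c (T + 1)).1
        have h7 : ((1 : ℝ) / 2) ^ T = 2 * (1 / 2) ^ (T + 1) := by ring
        simp only [serviceCost, movementCost, Finset.sum_range_succ, movePot] at ih h3 ⊢
        linarith [h4.1, h4.2]
    have h3 := key T
    have h4 := abs_le.1 (abs_movePot_le hω hδ h1 h2 (F x₀ c T).2.2.2.1 (y T).2)
    have h5 := abs_le.1 (abs_movePot_le hω hδ h1 h2 (F x₀ c 0).2.2.2.1 (y 0).2)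
    have h6 : (0 : ℝ) ≤ (1 / 2) ^ T := by positivity
    have h7 := wdist_nonneg hω (A.run x₀ c T).1 (alloc (F x₀ c T).2.2.1)
    have h8 := wdist_le_sum hω (A.run x₀ c 0).2
      (alloc_mem_stdSimplex (F x₀ c 0).2.2.2.1 (F x₀ c 0).2.2.2.2)
    have h9 : movementCost (A.run x₀ c) T =
        Λ * ∑ t ∈ Finset.range T, wdist ω (A.run x₀ c t).1 (A.run x₀ c (t + 1)).1 := by
      rw [movementCost, Finset.mul_sum]
      exact Finset.sum_congr rfl fun t _ => by rw [stepMovementCost_eq hw hd, hwω]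
    rw [h9]
    have h10 : ∑ t ∈ Finset.range T, wdist ω (A.run x₀ c t).1 (A.run x₀ c (t + 1)).1 ≤
        4 * (movementCost y T + serviceCost c y T) +
          (∑ i, ω i + 2 * ((1 + 4 * Λ) * ∑ i, ω i) + 1) := by
      linarith [h4.1, h5.2]
    have h11 := mul_le_mul_of_nonneg_left h10 hΛ0.le
    linarith

theorem movementCost_nonneg {M : Type*} [Fintype M] [MetricSpace M] {w : M → ℝ}
    (hw : ∀ i, 0 < w i) (hd : ∀ i j, i ≠ j → dist i j = w i + w j) (x : ℕ → Allocation M)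
    (T : ℕ) : 0 ≤ movementCost x T :=
  Finset.sum_nonneg fun t _ => by
    rw [stepMovementCost_eq hw hd]
    exact wdist_nonneg hw _ _

theorem theorem2 :
    ∃ C : ℝ, 0 < C ∧
      ∀ (M : Type*) [Fintype M] [Nonempty M] [MetricSpace M], IsWeightedStar M →
        ∀ ε : ℝ, 0 < ε →
          ∃ A : OnlineAlgorithm M,
            HasCompetitiveServiceCost A (1 + ε) ∧
            HasCompetitiveMovementCost A (C * (1 / ε + Real.log (Fintype.card M))) := by
  refine ⟨4, by norm_num, fun M _ _ _ hM ε hε => ?_⟩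
  obtain ⟨w, hw, hd⟩ := hM
  have hopt : ∀ (c : ℕ → TaskVector M) (T : ℕ) (y : ℕ → Allocation M),
      0 ≤ movementCost y T + serviceCost c y T := fun c T y =>
    add_nonneg (movementCost_nonneg hw hd y T) (serviceCost_nonneg c y T)
  have hε' : 0 ≤ 1 / ε := by positivity
  rcases le_or_gt (Fintype.card M) 1 with h | h
  · -- on a single point there is only one allocation
    have hsub : Subsingleton M := Fintype.card_le_one_iff_subsingleton.1 h
    have heq : ∀ x y : Allocation M, x = y := fun x y => by
      have hval : ∀ (z : Allocation M) i, z.1 i = 1 := fun z i => by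
        have := z.2.2
        rwa [Fintype.sum_subsingleton _ i] at this
      exact Subtype.ext (funext fun i => by rw [hval x, hval y])
    refine ⟨⟨fun x₀ _ => x₀⟩, ⟨0, fun x₀ c T y => ?_⟩, ⟨0, fun x₀ c T y => ?_⟩⟩
    · have h1 := movementCost_nonneg hw hd y T
      have h2 := hopt c T y
      rw [show OnlineAlgorithm.run _ x₀ c = y from funext fun t => heq _ _]
      nlinarith
    · have h0 : movementCost (OnlineAlgorithm.run ⟨fun x₀ _ => x₀⟩ x₀ c) T = 0 :=
        Finset.sum_eq_zero fun t _ => by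
          rw [stepMovementCost_eq hw hd, heq (OnlineAlgorithm.run _ x₀ c (t + 1))
            (OnlineAlgorithm.run _ x₀ c t), wdist_self]
      rw [h0, add_zero]
      exact mul_nonneg (mul_nonneg (by norm_num)
        (add_nonneg hε' (Real.log_natCast_nonneg _))) (hopt c T y)
  · obtain ⟨A, ⟨K, hK⟩, ⟨K', hK'⟩⟩ := exists_algorithm hw hd h
    refine ⟨A, ⟨K, fun x₀ c T y => (hK x₀ c T y).trans ?_⟩,
      ⟨K', fun x₀ c T y => (hK' x₀ c T y).trans ?_⟩⟩
    · have := mul_nonneg hε.le (hopt c T y)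
      linarith
    · have := mul_nonneg hε' (hopt c T y)
      linarith
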